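/- Let $n\ge 3$, and let $L$ be a countable nonstandard model of the first-order theory $Th(\mathbb Q)$ of the field $\mathbb Q$ of rational numbers in the language of rings; that is, $L$ is a countable field that satisfies the same first-order sentences as $\mathbb Q$ and is not isomorphic to $\mathbb Q$. Then the multiplicative group $L^\times$ contains a nontrivial countable torsion-free divisible subgroup. Moreover, for every nontrivial divisible subgroup $D\le L^\times$: 1. $GL_n(\mathbb Q)\times D\equiv GL_n(\mathbb Q)$, i.e. the two groups satisfy the same first-order sentences in the language of groups; 2. $GL_n(\mathbb Q)\times D$ is not isomorphic, as a group, to $GL_n(F)$ for any field $F$. (An abelian group $D$ is divisible if for each $d\in D$ and each integer $m\ge 1$ there is $e\in D$ with $e^m=d$.) -/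

import Mathlib

open scoped FirstOrder

/-- The function symbols of the language of groups: multiplication, inversion, identity. -/
inductive GroupFunc : ℕ → Type
  | mul : GroupFunc 2
  | inv : GroupFunc 1
  | one : GroupFunc 0

/-- The first-order language of groups, with symbols for `·`, `⁻¹`, `1` and no relation symbols
besides equality. -/
def groupLanguage : FirstOrder.Language.{0, 0} where
  Functions := GroupFunc
  Relations := fun _ => Empty

/-- A group, regarded as a structure for the first-order language of groups. -/
@[reducible]
def groupStructure (G : Type*) [Group G] : groupLanguage.Structure G where
  funMap := fun {n} f =>
    match n, f with
    | _, .mul => fun x => x 0 * x 1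
    | _, .inv => fun x => (x 0)⁻¹
    | _, .one => fun _ => 1
  RelMap := fun {_} r _ => r.elim

/-- A field, regarded as a structure for Mathlib's first-order language of rings. -/
@[reducible]
def fieldStructure (K : Type*) [Field K] : FirstOrder.Language.ring.Structure K :=
  (FirstOrder.Ring.compatibleRingOfRing K).toStructure

/-- Two groups satisfy the same first-order sentences in the language of groups. -/
def GroupElemEquiv (G H : Type*) [Group G] [Group H] : Prop :=
  letI := groupStructure G
  letI := groupStructure H
  G ≅[groupLanguage] H

/-- `Th(ℚ)`: all first-order sentences in the language of rings that hold in the field `ℚ`. -/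
def theoryRat : FirstOrder.Language.ring.Theory :=
  letI := fieldStructure ℚ
  FirstOrder.Language.ring.completeTheory ℚ

/-- The field `L` is a nonstandard model of `Th(ℚ)`: a model that is not isomorphic to `ℚ`. -/
def IsNonstandardModelRat (L : Type*) [Field L] : Prop :=
  (letI := fieldStructure L
   theoryRat.Model L) ∧ IsEmpty (L ≃+* ℚ)

/-- A group `D` is divisible (radicable): each element has an `m`-th root for all `m ≥ 1`. -/
def IsDivisibleGroup (D : Type*) [Group D] : Prop :=
  ∀ m : ℕ, 1 ≤ m → ∀ d : D, ∃ e : D, e ^ m = d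

/-! The existence of `D` rests on definability in `ℚ`. Legendre-type solvability of ternary forms
and quadratic reciprocity show that, for suitable primes `p`, `q`, `RobinsonRel` says that neither
divides the denominator of `k`. Intersecting all such sets that are stable under successor and
halving defines `ℤ[1/2]`. Its positive units are the powers of 2, and sums of four squares define
the order, so divisibility between numbers `2 ^ j - 1` gives first-order access to exponents: `2 ^ m
- 1 ∣ 2 ^ k - 1` forces `m ∣ k`. For every power `w` of 2, `ℚ` contains some `x = 2 ^ (J !)`, with
`J` one more than the absolute exponent of `w`, which is an `m`-th power for all `m` up to that
exponent. In `L` there is a nonstandard `w`, and the corresponding `x ≠ 1` has roots of every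
standard order. The elements with all roots form a divisible group, because roots in `L` are unique
up to sign.

For the elementary equivalence, `GL_n(ℚ) ≡ GL_n(L)`, since the group is interpreted in the field by
the entries of a matrix and its inverse. Scalars and the determinant split `GL_n(L)` as `H × D`. A
nontrivial divisible torsion-free group satisfies `D × D ≡ D`: an ultrapower is an
infinite-dimensional rational vector space, isomorphic to its square. Products preserve elementary
equivalence, so `GL_n(ℚ) × D ≡ H × D × D ≡ H × D ≅ GL_n(L) ≡ GL_n(ℚ)`.

For the non-isomorphism, a transvection is conjugate to all its positive powers, so its image in
`GL_n(F)` is unipotent. A one-parameter group `1 + a • B` in the double centralizer of that image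
pulls back to an additive embedding of `F` in `ℚ`, whence `F ≅ ℚ`. The factor `D` then lands in the
scalars `Fˣ ≅ ℚˣ`, where only 1 has roots of all orders. -/

/-! ### Legendre's theorem on ternary quadratic forms -/

/-- The pigeonhole step: a short nonzero vector in a sublattice of `ℤ³` given by three congruences. -/
theorem exists_short_vector_of_congr {a b c : ℕ} (ha : 0 < a) (hb : 0 < b) (hc : 0 < c)
    (α β γ : ℤ) : ∃ x y z : ℤ, ¬ (x = 0 ∧ y = 0 ∧ z = 0) ∧
      x ^ 2 ≤ (b * c : ℕ) ∧ y ^ 2 ≤ (a * c : ℕ) ∧ z ^ 2 ≤ (a * b : ℕ) ∧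
      (a : ℤ) ∣ y - β * z ∧ (b : ℤ) ∣ x - γ * z ∧ (c : ℤ) ∣ x - α * y := by
  have : NeZero a := ⟨ha.ne'⟩
  have : NeZero b := ⟨hb.ne'⟩
  have : NeZero c := ⟨hc.ne'⟩
  let f : Fin ((b * c).sqrt + 1) × Fin ((a * c).sqrt + 1) × Fin ((a * b).sqrt + 1) →
      ZMod a × ZMod b × ZMod c := fun v =>
    ((((v.2.1 : ℕ) : ℤ) - β * ((v.2.2 : ℕ) : ℤ) : ℤ),
      (((v.1 : ℕ) : ℤ) - γ * ((v.2.2 : ℕ) : ℤ) : ℤ),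
      (((v.1 : ℕ) : ℤ) - α * ((v.2.1 : ℕ) : ℤ) : ℤ))
  have hcard : Fintype.card (ZMod a × ZMod b × ZMod c) < Fintype.card
      (Fin ((b * c).sqrt + 1) × Fin ((a * c).sqrt + 1) × Fin ((a * b).sqrt + 1)) := by
    simp only [Fintype.card_prod, ZMod.card, Fintype.card_fin]
    have h1 := Nat.lt_succ_sqrt' (b * c)
    have h2 := Nat.lt_succ_sqrt' (a * c)
    have h3 := Nat.lt_succ_sqrt' (a * b)
    -- The radicands `bc`, `ac`, `ab` multiply to `(abc)²`, so the box has more than `abc` points.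
    refine lt_of_pow_lt_pow_left₀ 2 (by positivity) ?_
    calc (a * (b * c)) ^ 2 = (b * c) * ((a * c) * (a * b)) := by ring
      _ < ((b * c).sqrt.succ ^ 2) * (((a * c).sqrt.succ ^ 2) * ((a * b).sqrt.succ ^ 2)) := by
        gcongr
      _ = _ := by simp only [Nat.succ_eq_add_one]; ring
  obtain ⟨v, w, hvw, hf⟩ := Fintype.exists_ne_map_eq_of_card_lt f hcard
  obtain ⟨⟨x1, hx1⟩, ⟨y1, hy1⟩, ⟨z1, hz1⟩⟩ := v
  obtain ⟨⟨x2, hx2⟩, ⟨y2, hy2⟩, ⟨z2, hz2⟩⟩ := w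
  simp only [f, Prod.mk.injEq, ZMod.intCast_eq_intCast_iff_dvd_sub] at hf
  obtain ⟨h1, h2, h3⟩ := hf
  have key : ∀ {s n t1 t2 : ℕ}, s = n.sqrt → t1 < s + 1 → t2 < s + 1 →
      ((t2 : ℤ) - t1) ^ 2 ≤ n := by
    intro s n t1 t2 hs h1 h2
    have h4 := Nat.sqrt_le' n
    rw [← hs] at h4
    have : ((t2 : ℤ) - t1) ^ 2 ≤ (s : ℤ) ^ 2 := by
      apply sq_le_sq'
      · lia
      · lia
    exact this.trans (by exact_mod_cast h4)
  have hx := key rfl hx1 hx2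
  have hy := key rfl hy1 hy2
  have hz := key rfl hz1 hz2
  have hne : ¬ ((x2 : ℤ) - x1 = 0 ∧ (y2 : ℤ) - y1 = 0 ∧ (z2 : ℤ) - z1 = 0) := by
    rintro ⟨e1, e2, e3⟩
    apply hvw
    have : x1 = x2 := by lia
    have : y1 = y2 := by lia
    have : z1 = z2 := by lia
    subst_vars
    rfl
  have h1' : (a : ℤ) ∣ ((y2 : ℤ) - y1) - β * ((z2 : ℤ) - z1) := by convert h1 using 1; ring
  have h2' : (b : ℤ) ∣ ((x2 : ℤ) - x1) - γ * ((z2 : ℤ) - z1) := by convert h2 using 1; ring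
  have h3' : (c : ℤ) ∣ ((x2 : ℤ) - x1) - α * ((y2 : ℤ) - y1) := by convert h3 using 1; ring
  exact ⟨_, _, _, hne, hx, hy, hz, h1', h2', h3'⟩

/-- At a short vector of the lattice the form is a multiple of `abc` lying strictly between `-abc`
and `2abc`, hence is `0` or `abc`. The non-square hypotheses make the bounds strict. -/
theorem exists_sq_add_sq_eq_of_congr {a b c : ℕ} (ha : 0 < a) (hb : 0 < b) (hc : 0 < c)
    (hab : a.Coprime b) (hac : a.Coprime c) (hbc : b.Coprime c)
    (hsab : ¬ IsSquare (a * b)) (hsbc : ¬ IsSquare (b * c)) {α β γ : ℤ}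
    (hα : (c : ℤ) ∣ a * α ^ 2 + b) (hβ : (a : ℤ) ∣ b * β ^ 2 - c)
    (hγ : (b : ℤ) ∣ a * γ ^ 2 - c) :
    ∃ x y z : ℤ, z ≠ 0 ∧ a * x ^ 2 + b * y ^ 2 = c * z ^ 2 := by
  obtain ⟨x, y, z, hne, hx, hy, hz, h1', h2', h3'⟩ :=
    exists_short_vector_of_congr ha hb hc α β γ
  have hsq : ∀ {n : ℕ} {t : ℤ}, ¬ IsSquare n → t ^ 2 ≤ n → t ^ 2 < n := by
    intro n t hn ht
    refine lt_of_le_of_ne ht fun h => hn ⟨t.natAbs, ?_⟩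
    zify
    rw [← h, ← sq, sq_abs]
  have hx' := hsq hsbc hx
  have hz' := hsq hsab hz
  push_cast at hx' hz' hy
  have ha' : (0 : ℤ) < a := by exact_mod_cast ha
  have hb' : (0 : ℤ) < b := by exact_mod_cast hb
  have hc' : (0 : ℤ) < c := by exact_mod_cast hc
  have da : (a : ℤ) ∣ a * x ^ 2 + b * y ^ 2 - c * z ^ 2 := by
    obtain ⟨s, hs⟩ := h1'
    obtain ⟨t, ht⟩ := hβ
    refine ⟨x ^ 2 + b * (2 * β * z * s + a * s ^ 2) + t * z ^ 2, ?_⟩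
    rw [sub_eq_iff_eq_add.1 hs]
    linear_combination z ^ 2 * ht
  have db : (b : ℤ) ∣ a * x ^ 2 + b * y ^ 2 - c * z ^ 2 := by
    obtain ⟨s, hs⟩ := h2'
    obtain ⟨t, ht⟩ := hγ
    refine ⟨y ^ 2 + a * (2 * γ * z * s + b * s ^ 2) + t * z ^ 2, ?_⟩
    rw [sub_eq_iff_eq_add.1 hs]
    linear_combination z ^ 2 * ht
  have dc : (c : ℤ) ∣ a * x ^ 2 + b * y ^ 2 - c * z ^ 2 := by
    obtain ⟨s, hs⟩ := h3'
    obtain ⟨t, ht⟩ := hα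
    refine ⟨-z ^ 2 + a * (2 * α * y * s + c * s ^ 2) + t * y ^ 2, ?_⟩
    rw [sub_eq_iff_eq_add.1 hs]
    linear_combination y ^ 2 * ht
  have dabc : ((a : ℤ) * b * c) ∣ a * x ^ 2 + b * y ^ 2 - c * z ^ 2 := by
    apply IsCoprime.mul_dvd _ (IsCoprime.mul_dvd _ da db) dc
    · exact IsCoprime.mul_left (Nat.isCoprime_iff_coprime.2 hac) (Nat.isCoprime_iff_coprime.2 hbc)
    · exact Nat.isCoprime_iff_coprime.2 hab
  obtain ⟨k, hk⟩ := dabc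
  have hpos : (0 : ℤ) < a * b * c := by positivity
  have b1 : (a : ℤ) * x ^ 2 < a * b * c := by
    linarith [mul_lt_mul_of_pos_left hx' ha']
  have b2 : (b : ℤ) * y ^ 2 ≤ a * b * c := by
    linarith [mul_le_mul_of_nonneg_left hy hb'.le]
  have b3 : (c : ℤ) * z ^ 2 < a * b * c := by
    linarith [mul_lt_mul_of_pos_left hz' hc']
  have b4 : (0 : ℤ) ≤ a * x ^ 2 := by positivity
  have b5 : (0 : ℤ) ≤ b * y ^ 2 := by positivity
  have b6 : (0 : ℤ) ≤ c * z ^ 2 := by positivity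
  have hk1 : -1 < k := by nlinarith
  have hk2 : k < 2 := by nlinarith
  obtain rfl | rfl : k = 0 ∨ k = 1 := by lia
  · refine ⟨x, y, z, ?_, by linarith⟩
    rintro rfl
    have e1 : (a : ℤ) * x ^ 2 = 0 := by linarith
    have e2 : (b : ℤ) * y ^ 2 = 0 := by linarith
    simp [ha.ne', hb.ne'] at e1 e2
    exact hne ⟨e1, e2, rfl⟩
  -- From `a(xz + by)² + b(yz - ax)² = (z² + ab)(ax² + by²)`, where now `ax² + by² = c(z² + ab)`.
  · refine ⟨x * z + b * y, y * z - a * x, z ^ 2 + a * b, by positivity, ?_⟩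
    linear_combination (z ^ 2 + a * b) * hk

/-! ### Defining `ℤ[1/2]` in `ℚ` by Robinson's relation -/

section

open scoped NumberTheorySymbols

/-- The relation between `k` and the parameters `a`, `b`, from which the ring of dyadic rationals is
defined. -/
def RobinsonRel (K : Type*) [Field K] (a b k : K) : Prop :=
  ∃ x y z : K, x ^ 2 + a * y ^ 2 - b * z ^ 2 = 1 + a * b * k ^ 2

theorem exists_sq_eq_neg_mul_of_jacobiSym {l a b : ℕ} (hl : l.Prime) (hal : ¬ l ∣ a)
    (h : J(-(a * b) | l) = 1) : ∃ α : ℤ, (l : ℤ) ∣ a * α ^ 2 + b := by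
  have : Fact l.Prime := ⟨hl⟩
  obtain ⟨r, hr⟩ := ZMod.isSquare_of_jacobiSym_eq_one h
  obtain ⟨α, hα⟩ := ZMod.intCast_surjective (r / (a : ZMod l))
  have ha : (a : ZMod l) ≠ 0 := by rwa [Ne, ZMod.natCast_eq_zero_iff]
  refine ⟨α, (ZMod.intCast_zmod_eq_zero_iff_dvd _ _).1 ?_⟩
  push_cast at hr ⊢
  rw [hα]
  field_simp
  linear_combination -hr

theorem exists_prime_modEq_three {a b c x y z : ℕ} (N : ℕ) (ha : a ≠ 0) (hb : b ≠ 0) (hc : c ≠ 0)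
    (hab : a.Coprime b) (hac : a.Coprime c) (hbc : b.Coprime c)
    (hx : x.Coprime a) (hy : y.Coprime b) (hz : z.Coprime c) :
    ∃ l > N, l.Prime ∧ l ≡ x [MOD a] ∧ l ≡ y [MOD b] ∧ l ≡ z [MOD c] := by
  obtain ⟨w, hw1, hw2⟩ := Nat.chineseRemainder hbc y z
  obtain ⟨v, hv1, hv2⟩ := Nat.chineseRemainder (Nat.Coprime.mul_right hab hac) x w
  have hva : v.Coprime a := by rw [Nat.Coprime, hv1.gcd_eq]; exact hx
  have hvb : v.Coprime b := by
    rw [Nat.Coprime, ((hv2.of_mul_right c).trans hw1).gcd_eq]; exact hy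
  have hvc : v.Coprime c := by
    rw [Nat.Coprime, ((hv2.of_mul_left b).trans hw2).gcd_eq]; exact hz
  obtain ⟨l, hl, hlp, hlv⟩ := Nat.forall_exists_prime_gt_and_modEq N (q := a * (b * c)) (a := v)
    (by positivity) (Nat.Coprime.mul_right hva (Nat.Coprime.mul_right hvb hvc))
  have h2 : l ≡ w [MOD b * c] := (hlv.of_mul_left a).trans hv2
  exact ⟨l, hl, hlp, (hlv.of_mul_right _).trans hv1, (h2.of_mul_right c).trans hw1,
    (h2.of_mul_left b).trans hw2⟩

theorem not_isSquare_prime_mul {p d : ℕ} (hp : p.Prime) (h : p.Coprime d) :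
    ¬ IsSquare (p * d) := by
  rintro ⟨r, hr⟩
  have h1 : p ∣ r := by
    have : p ∣ r * r := ⟨d, hr.symm⟩
    rcases hp.dvd_mul.1 this with h | h <;> exact h
  obtain ⟨s, rfl⟩ := h1
  have h2 : d = p * (s * s) :=
    Nat.eq_of_mul_eq_mul_left hp.pos (by rw [hr]; ring)
  exact hp.coprime_iff_not_dvd.1 h ⟨_, h2⟩

/-- An auxiliary prime `l` splits the quaternary problem into `X² + qY² = lZ²` and `du² + pv² =
lw²`; scaling both to the same value of `l(w/u)²` and subtracting gives the representation. -/
theorem exists_rat_represent {p q d : ℕ} (hp : p.Prime) (hq : q.Prime) (hp4 : p % 4 = 1)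
    (hq4 : q % 4 = 3) (hd : d % 2 = 1) (hpd : p.Coprime d) (hqd : q.Coprime d) :
    ∃ x y z : ℚ, x ^ 2 + q * y ^ 2 - p * z ^ 2 = d := by
  have hpq : p ≠ q := by rintro rfl; lia
  have hpq' : p.Coprime q := (Nat.coprime_primes hp hq).2 hpq
  have hd0 : d ≠ 0 := by rintro rfl; simp at hd
  have c4 : ∀ {r : ℕ}, r % 2 = 1 → Nat.Coprime 4 r := fun {r} hr =>
    Nat.Coprime.pow_left 2 (Nat.coprime_two_left.2 (Nat.odd_iff.2 hr))
  -- With `l ≡ 1` mod `4q`, `l ≡ d` mod `p` and `l ≡ p` mod `d`, reciprocity turns the second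
  -- solvability condition into `J(p | d)² = 1`. The size of `l` makes it coprime to `p`, `q`, `d`.
  obtain ⟨l, hl, hlp, hlq, hlpm, hld⟩ := exists_prime_modEq_three (a := 4 * q) (b := p) (c := d)
    (x := 1) (y := d) (z := p) (4 + p + q + d) (by have := hq.pos; positivity) hp.ne_zero hd0
    (Nat.Coprime.mul_left (c4 (by lia)) hpq'.symm)
    (Nat.Coprime.mul_left (c4 hd) hqd) hpd (Nat.coprime_one_left _) hpd.symm hpd
  have hl4 : l % 4 = 1 := hlq.of_mul_right q
  have hlq' : l ≡ 1 [MOD q] := hlq.of_mul_left 4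
  have cop : ∀ {r : ℕ}, 0 < r → r < l → l.Coprime r := fun {r} h0 hr =>
    (Nat.Prime.coprime_iff_not_dvd hlp).2 (Nat.not_dvd_of_pos_of_lt h0 hr)
  have oddd : Odd d := Nat.odd_iff.2 hd
  have oddq : Odd q := Nat.odd_iff.2 (by lia)
  have oddp : Odd p := Nat.odd_iff.2 (by lia)
  have oddl : Odd l := Nat.odd_iff.2 (by lia)
  have jneg : ∀ a : ℤ, J(-a | l) = J(a | l) := fun a => by
    rw [jacobiSym.neg _ oddl, ZMod.χ₄_nat_one_mod_four hl4, one_mul]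
  have jmod : ∀ {a b m : ℕ}, a ≡ b [MOD m] → J((a : ℤ) | m) = J((b : ℤ) | m) := fun {a b m} h =>
    jacobiSym.mod_left' (Int.natCast_modEq_iff.2 h)
  have hqpos := hq.pos
  have hppos := hp.pos
  have dvd_of : ∀ {a b m : ℕ}, a ≡ b [MOD m] → (m : ℤ) ∣ b - a := fun {a b m} h =>
    (Int.natCast_modEq_iff.2 h).dvd
  obtain ⟨α, hα⟩ : ∃ α : ℤ, (l : ℤ) ∣ (1 : ℕ) * α ^ 2 + q := by
    refine exists_sq_eq_neg_mul_of_jacobiSym hlp (mt Nat.dvd_one.1 hlp.one_lt.ne') ?_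
    · rw [jneg, Nat.cast_one, one_mul,
        jacobiSym.quadratic_reciprocity_one_mod_four' oddq hl4, jmod hlq']
      simp
  obtain ⟨β, hβ⟩ : ∃ β : ℤ, (l : ℤ) ∣ d * β ^ 2 + p := by
    refine exists_sq_eq_neg_mul_of_jacobiSym hlp
      ((Nat.Prime.coprime_iff_not_dvd hlp).1 (cop (Nat.pos_of_ne_zero hd0) (by lia))) ?_
    rw [jneg, jacobiSym.mul_left, jacobiSym.quadratic_reciprocity_one_mod_four' oddd hl4,
      jacobiSym.quadratic_reciprocity_one_mod_four' oddp hl4, jmod hld, jmod hlpm,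
      jacobiSym.quadratic_reciprocity_one_mod_four hp4 oddd, ← sq]
    apply jacobiSym.sq_one
    simpa [Int.gcd_natCast_natCast] using hpd.symm
  have d1 := dvd_of hlq'
  have d2 := dvd_of hlpm
  have d3 := dvd_of hld
  obtain ⟨X, Y, Z, hZ, hXYZ⟩ := exists_sq_add_sq_eq_of_congr (a := 1) (b := q) (c := l) (β := 0)
    (γ := 1) one_pos hq.pos hlp.pos (Nat.coprime_one_left _) (Nat.coprime_one_left _)
    (cop hq.pos (by lia)).symm
    (by rw [mul_comm]; exact not_isSquare_prime_mul hq (Nat.coprime_one_right _))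
    (not_isSquare_prime_mul hq (cop hq.pos (by lia)).symm) hα (by simp) (by simpa using d1)
  obtain ⟨u, v, w, hw, huvw⟩ := exists_sq_add_sq_eq_of_congr (a := d) (b := p) (c := l) (β := 1)
    (γ := 1) (Nat.pos_of_ne_zero hd0) hp.pos hlp.pos hpd.symm
    (cop (Nat.pos_of_ne_zero hd0) (by lia)).symm
    (cop hp.pos (by lia)).symm
    (by rw [mul_comm]; exact not_isSquare_prime_mul hp hpd)
    (not_isSquare_prime_mul hp (cop hp.pos (by lia)).symm) hβ
    (by simpa using d3) (by simpa using d2)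
  have hu : u ≠ 0 := by
    rintro rfl
    have hr : (l * p : ℚ) = (p * v / w) ^ 2 := by
      have hw' : (w : ℚ) ≠ 0 := by exact_mod_cast hw
      field_simp
      have : (d : ℚ) * (0 : ℤ) ^ 2 + p * v ^ 2 = l * w ^ 2 := by exact_mod_cast huvw
      push_cast at this
      linear_combination -this
    have hs : IsSquare ((l * p : ℕ) : ℚ) := ⟨_, by push_cast; rw [hr, sq]⟩
    exact not_isSquare_prime_mul hlp (cop hp.pos (by lia)) (Rat.isSquare_natCast_iff.1 hs)
  have hZ' : (Z : ℚ) ≠ 0 := by exact_mod_cast hZ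
  have hu' : (u : ℚ) ≠ 0 := by exact_mod_cast hu
  have e1 : (1 : ℚ) * X ^ 2 + q * Y ^ 2 = l * Z ^ 2 := by exact_mod_cast hXYZ
  have e2 : (d : ℚ) * u ^ 2 + p * v ^ 2 = l * w ^ 2 := by exact_mod_cast huvw
  refine ⟨X * w / (Z * u), Y * w / (Z * u), v / u, ?_⟩
  field_simp
  linear_combination (w : ℚ) ^ 2 * e1 - (Z : ℚ) ^ 2 * e2

/-- For `k = ±m/c` the right side is `(c² + pqm²)/c²`. Its numerator is odd or, when `c` and `m` are
both odd, congruent to 4 mod 8 because `pq ≡ 3`. Up to a square it is thus an odd `d` prime to `p`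
and `q`, which `exists_rat_represent` handles. -/
theorem robinsonRel_of_coprime_den {p q : ℕ} (hp : p.Prime) (hq : q.Prime) (hp4 : p % 4 = 1)
    (hpq : p * q % 8 = 3) {k : ℚ} (hpk : p.Coprime k.den) (hqk : q.Coprime k.den) :
    RobinsonRel ℚ q p k := by
  have hq4 : q % 4 = 3 := by
    have h1 : p * q % 4 = 3 := by lia
    rw [Nat.mul_mod, hp4] at h1
    lia
  set c := k.den with hc
  set m := k.num.natAbs with hm
  have hcm : m.Coprime c := k.reduced
  have hk : k ^ 2 = (m : ℚ) ^ 2 / (c : ℚ) ^ 2 := by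
    conv_lhs => rw [← Rat.num_div_den k]
    rw [div_pow, hm, ← hc, Nat.cast_natAbs]
    simp
  have hc0 : (c : ℚ) ≠ 0 := by exact_mod_cast k.den_nz
  have main : ∀ {d s : ℕ}, s ≠ 0 → s ^ 2 * d = c ^ 2 + p * q * m ^ 2 → d % 2 = 1 →
      RobinsonRel ℚ q p k := by
    intro d s hs0 hs hd
    have hpd : p.Coprime d := by
      have : p.Coprime (s ^ 2 * d) := by
        rw [hs, mul_assoc]
        simpa using hpk.pow_right 2
      exact this.coprime_mul_left_right
    have hqd : q.Coprime d := by
      have : q.Coprime (s ^ 2 * d) := by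
        rw [hs, mul_comm p, mul_assoc]
        simpa using hqk.pow_right 2
      exact this.coprime_mul_left_right
    obtain ⟨x, y, z, h⟩ := exists_rat_represent hp hq hp4 hq4 hd hpd hqd
    refine ⟨x * s / c, y * s / c, z * s / c, ?_⟩
    have hs' : (s : ℚ) ^ 2 * d = c ^ 2 + p * q * m ^ 2 := by exact_mod_cast hs
    rw [hk]
    field_simp
    linear_combination (s : ℚ) ^ 2 * h + hs'
  rcases Nat.even_or_odd (c ^ 2 + p * q * m ^ 2) with he | ho
  · have h8 : (c ^ 2 + p * q * m ^ 2) % 8 = 4 := by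
      have hodd : c % 2 = 1 ∧ m % 2 = 1 := by
        have h2 := Nat.even_iff.1 he
        have hpq2 : p * q % 2 = 1 := by lia
        rw [Nat.add_mod, Nat.mul_mod, hpq2, Nat.pow_mod, Nat.pow_mod m] at h2
        rcases Nat.mod_two_eq_zero_or_one c with h | h <;>
          rcases Nat.mod_two_eq_zero_or_one m with h' | h' <;> simp_all
        exact absurd (Nat.dvd_gcd (Nat.dvd_of_mod_eq_zero h') (Nat.dvd_of_mod_eq_zero h))
          (by rw [hcm]; decide)
      have hsq : ∀ {t : ℕ}, t % 2 = 1 → t ^ 2 % 8 = 1 := by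
        intro t ht
        have : t % 8 = 1 ∨ t % 8 = 3 ∨ t % 8 = 5 ∨ t % 8 = 7 := by lia
        rcases this with h | h | h | h <;> simp [Nat.pow_mod, h]
      rw [Nat.add_mod, Nat.mul_mod, hpq, hsq hodd.1, hsq hodd.2]
    exact main (d := (c ^ 2 + p * q * m ^ 2) / 4) (s := 2) two_ne_zero (by lia) (by lia)
  · exact main (s := 1) one_ne_zero (by ring) (Nat.odd_iff.1 ho)

/-- Descent: as `n` is a nonresidue, `r` divides a value of `X² - nY²` only if it divides both `X`
and `Y`. Applied to the left side and then to `Z² - nM²`, this takes a factor `r` out of every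
variable. -/
theorem pow_dvd_of_nonresidue {r : ℕ} (hr : r.Prime) {n ε : ℤ} (hn : J(n | r) = -1)
    (hε : ε = 1 ∨ ε = -1) (k : ℕ) {X Y Z M W : ℤ}
    (h : X ^ 2 - n * Y ^ 2 = r * ε * (Z ^ 2 - n * M ^ 2) + W ^ 2) (hW : (r : ℤ) ^ k ∣ W) :
    (r : ℤ) ^ k ∣ M := by
  have : Fact r.Prime := ⟨hr⟩
  have hr0 : (r : ℤ) ≠ 0 := by exact_mod_cast hr.ne_zero
  induction k generalizing X Y Z M W with
  | zero => simp
  | succ k ih =>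
    obtain ⟨W', rfl⟩ := hW
    obtain ⟨⟨X', rfl⟩, ⟨Y', rfl⟩⟩ := jacobiSym.prime_dvd_of_eq_neg_one (p := r) hn (x := X) (y := Y)
      ⟨ε * (Z ^ 2 - n * M ^ 2) + r * (r ^ k * W') ^ 2, by rw [h]; ring⟩
    have h1 : (r : ℤ) * (X' ^ 2 - n * Y' ^ 2) =
        ε * (Z ^ 2 - n * M ^ 2) + r * (r ^ k * W') ^ 2 := by
      apply mul_left_cancel₀ hr0
      linear_combination h
    have h2 : ε * ε = 1 := by rcases hε with rfl | rfl <;> rfl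
    obtain ⟨⟨Z', rfl⟩, ⟨M', rfl⟩⟩ := jacobiSym.prime_dvd_of_eq_neg_one (p := r) hn (x := Z) (y := M)
      ⟨ε * (X' ^ 2 - n * Y' ^ 2 - (r ^ k * W') ^ 2), by
        linear_combination -(Z ^ 2 - n * M ^ 2) * h2 - ε * h1⟩
    rw [pow_succ']
    refine mul_dvd_mul_left _ (ih (X := X') (Y := Y') (Z := Z') (W := r ^ k * W') ?_ ⟨_, rfl⟩)
    apply mul_left_cancel₀ hr0
    linear_combination h1

theorem coprime_den_of_nonresidue {r : ℕ} (hr : r.Prime) {n ε : ℤ} (hn : J(n | r) = -1)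
    (hε : ε = 1 ∨ ε = -1) {x y z k : ℚ}
    (h : x ^ 2 - n * y ^ 2 = r * ε * (z ^ 2 - n * k ^ 2) + 1) : r.Coprime k.den := by
  rw [hr.coprime_iff_not_dvd]
  rintro hdvd
  obtain ⟨N, hN0, X, Y, Z, hX, hY, hZ⟩ : ∃ N : ℕ, N ≠ 0 ∧ ∃ X Y Z : ℤ,
      (X : ℚ) = x * N ∧ (Y : ℚ) = y * N ∧ (Z : ℚ) = z * N := by
    refine ⟨x.den * y.den * z.den, by simp, x.num * y.den * z.den, y.num * x.den * z.den,
      z.num * x.den * y.den, ?_, ?_, ?_⟩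
    · push_cast; rw [← Rat.mul_den_eq_num x]; ring
    · push_cast; rw [← Rat.mul_den_eq_num y]; ring
    · push_cast; rw [← Rat.mul_den_eq_num z]; ring
  have hk : (k.num : ℚ) = k * k.den := by
    rw [Rat.mul_den_eq_num]
  have hint : (X * k.den) ^ 2 - n * (Y * k.den) ^ 2 =
      r * ε * ((Z * k.den) ^ 2 - n * (k.num * N) ^ 2) + ((N : ℤ) * k.den) ^ 2 := by
    have : ((X : ℚ) * k.den) ^ 2 - n * (Y * k.den) ^ 2 =
        r * ε * ((Z * k.den) ^ 2 - n * (k.num * N) ^ 2) + ((N : ℚ) * k.den) ^ 2 := by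
      rw [hX, hY, hZ, hk]
      linear_combination (N * k.den : ℚ) ^ 2 * h
    exact_mod_cast this
  -- If `r` divided the denominator, `N * k.den` would carry one more factor `r` than `N`; the
  -- descent would pass it to `k.num * N`, hence to `k.num`.
  obtain ⟨e, N', hN', hNe⟩ := Nat.exists_eq_pow_mul_and_not_dvd hN0 r hr.ne_one
  obtain ⟨d, hd⟩ := hdvd
  have h1 : (r : ℤ) ^ (e + 1) ∣ k.num * N := by
    refine pow_dvd_of_nonresidue hr hn hε (e + 1) hint ⟨N' * d, ?_⟩
    rw [hNe, hd]
    push_cast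
    ring
  rw [hNe] at h1
  have h2 : (r : ℤ) ∣ k.num * N' := by
    obtain ⟨t, ht⟩ := h1
    refine ⟨t, mul_left_cancel₀ (pow_ne_zero e (by exact_mod_cast hr.ne_zero : (r : ℤ) ≠ 0)) ?_⟩
    push_cast at ht
    linear_combination ht
  rcases (Nat.prime_iff_prime_int.1 hr).dvd_or_dvd h2 with h3 | h3
  · have h4 := Nat.dvd_gcd (Int.natCast_dvd.1 h3) ⟨d, hd⟩
    rw [k.reduced] at h4
    exact hr.one_lt.ne' (Nat.dvd_one.1 h4)
  · exact hN' (by exact_mod_cast h3)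

theorem exists_nat_jacobiSym_eq_neg_one {p : ℕ} (hp : p.Prime) (h2 : p ≠ 2) :
    ∃ a : ℕ, a.Coprime p ∧ J(a | p) = -1 := by
  have : Fact p.Prime := ⟨hp⟩
  obtain ⟨a, ha⟩ := FiniteField.exists_nonsquare (F := ZMod p) (by rwa [ZMod.ringChar_zmod_n])
  have hJ : J((a.val : ℕ) | p) = -1 := by
    rw [ZMod.nonsquare_iff_jacobiSym_eq_neg_one]
    simpa using ha
  refine ⟨a.val, ?_, hJ⟩
  by_contra hc
  have := (jacobiSym.eq_zero_iff (a := (a.val : ℤ)) (b := p)).2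
    ⟨hp.ne_zero, by rwa [Int.gcd_natCast_natCast]⟩
  rw [hJ] at this
  exact absurd this (by decide)

theorem exists_prime_partner {P : ℕ} (hP : P.Prime) (hP2 : P ≠ 2) :
    ∃ Q : ℕ, Q.Prime ∧ P * Q % 8 = 3 ∧ J(Q | P) = -1 := by
  obtain ⟨a, ha, haJ⟩ := exists_nat_jacobiSym_eq_neg_one hP hP2
  have hodd : P % 2 = 1 := hP.mod_two_eq_one_iff_ne_two.2 hP2
  have h8 : P.Coprime 8 :=
    Nat.Coprime.pow_right 3 (Nat.coprime_two_right.2 (Nat.odd_iff.2 hodd))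
  -- `Q ≡ 3P` mod 8 gives `PQ ≡ 3P² ≡ 3`; the modulus 1 is a dummy.
  obtain ⟨Q, -, hQ, hQ8, hQP, -⟩ := exists_prime_modEq_three (a := 8) (b := P) (c := 1)
    (x := 3 * P) (y := a) (z := 0) 0 (by norm_num) hP.ne_zero one_ne_zero h8.symm
    (Nat.coprime_one_right _) (Nat.coprime_one_right _)
    (Nat.Coprime.mul_left (by norm_num) h8) ha (Nat.coprime_one_right _)
  refine ⟨Q, hQ, ?_, ?_⟩
  · have h1 : P * Q ≡ P * (3 * P) [MOD 8] := hQ8.mul_left P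
    have h3 : P % 8 = 1 ∨ P % 8 = 3 ∨ P % 8 = 5 ∨ P % 8 = 7 := by lia
    rw [h1]
    rcases h3 with h | h | h | h <;> simp [Nat.mul_mod, h]
  · rw [← haJ]
    exact jacobiSym.mod_left' (Int.natCast_modEq_iff.2 hQP)

/-- The equation reads `x² + qy² = p(z² + qk²) + 1` and also `x² - pz² = -q(y² - pk²) + 1`. Since `p
≡ 1` mod 4, both `-q` mod `p` and `p` mod `q` are nonresidues, so the descent applies at each prime.
-/
theorem robinsonRel_iff {p q : ℕ} (hp : p.Prime) (hq : q.Prime) (hp4 : p % 4 = 1)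
    (hpq : p * q % 8 = 3) (hJ : J(q | p) = -1) {k : ℚ} :
    RobinsonRel ℚ q p k ↔ p.Coprime k.den ∧ q.Coprime k.den := by
  refine ⟨?_, fun h => robinsonRel_of_coprime_den hp hq hp4 hpq h.1 h.2⟩
  have hqodd : Odd q := by
    rw [Nat.odd_iff]
    by_contra h
    have : Even (p * q) := (Nat.even_iff.2 (by lia)).mul_left p
    rw [Nat.even_iff] at this
    lia
  have hpodd : Odd p := Nat.odd_iff.2 (by lia)
  rintro ⟨x, y, z, h⟩
  constructor
  · refine coprime_den_of_nonresidue hp (n := -q) (ε := 1) ?_ (Or.inl rfl) (x := x) (y := y)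
      (z := z) ?_
    · rw [jacobiSym.neg _ hpodd, ZMod.χ₄_nat_one_mod_four hp4, one_mul, hJ]
    · push_cast
      linear_combination h
  · refine coprime_den_of_nonresidue hq (n := p) (ε := -1) ?_ (Or.inr rfl) (x := x) (y := z)
      (z := y) ?_
    · rw [jacobiSym.quadratic_reciprocity_one_mod_four hp4 hqodd, hJ]
    · push_cast
      linear_combination h

/-- On `ℚ` this formula defines the ring `ℤ[1/2]`. -/
def DyadicRel (K : Type*) [Field K] (k : K) : Prop :=
  ∀ a b : K, (∀ m, RobinsonRel K a b m → RobinsonRel K a b (m + 1)) →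
    (∀ m, RobinsonRel K a b (2 * m) → RobinsonRel K a b m) → RobinsonRel K a b k

theorem DyadicRel.coprime_den {k : ℚ} (hk : DyadicRel ℚ k) {P : ℕ} (hP : P.Prime) (hP2 : P ≠ 2) :
    P.Coprime k.den := by
  have key : ∀ {p q : ℕ}, p.Prime → q.Prime → p % 4 = 1 → p * q % 8 = 3 → J(q | p) = -1 →
      p.Coprime k.den ∧ q.Coprime k.den := by
    intro p q hp hq hp4 hpq hJ
    have hiff := fun k => robinsonRel_iff hp hq hp4 hpq hJ (k := k)
    have hq2 : q.Coprime 2 := by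
      rw [Nat.coprime_two_right, Nat.odd_iff]
      by_contra h
      have : Even (p * q) := (Nat.even_iff.2 (by lia)).mul_left p
      rw [Nat.even_iff] at this
      lia
    have hp2 : p.Coprime 2 := by rw [Nat.coprime_two_right, Nat.odd_iff]; lia
    rw [← hiff]
    refine hk q p (fun m => ?_) (fun m => ?_) <;> rw [hiff, hiff]
    · have hd := Rat.add_den_dvd m 1
      rw [Rat.den_one, mul_one] at hd
      exact fun h => ⟨h.1.coprime_dvd_right hd, h.2.coprime_dvd_right hd⟩
    · have hd := Rat.mul_den_dvd (2 * m) (1 / 2)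
      rw [show 2 * m * (1 / 2) = m by ring, show (1 / 2 : ℚ).den = 2 by norm_num] at hd
      exact fun h => ⟨(h.1.mul_right hp2).coprime_dvd_right hd,
        (h.2.mul_right hq2).coprime_dvd_right hd⟩
  obtain ⟨Q, hQ, h8, hJ⟩ := exists_prime_partner hP hP2
  have hodd : P % 2 = 1 := hP.mod_two_eq_one_iff_ne_two.2 hP2
  -- One of `P`, `Q` is 1 mod 4 since `PQ ≡ 3`; that one plays the role of `p`.
  have h4 : P % 4 = 1 ∨ P % 4 = 3 := by lia
  rcases h4 with h4 | h4
  · exact (key hP hQ h4 h8 hJ).1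
  · have hQ4 : Q % 4 = 1 := by
      have h1 : P * Q % 4 = 3 := by lia
      rw [Nat.mul_mod, h4] at h1
      lia
    refine (key hQ hP hQ4 (by rwa [mul_comm]) ?_).2
    rw [jacobiSym.quadratic_reciprocity_one_mod_four' (Nat.odd_iff.2 hodd) hQ4, hJ]

theorem dyadicRel_iff {k : ℚ} : DyadicRel ℚ k ↔ ∃ (n : ℕ) (m : ℤ), 2 ^ n * k = m := by
  constructor
  · intro h
    refine ⟨k.den.primeFactorsList.length, k.num, ?_⟩
    have h2 : k.den = 2 ^ k.den.primeFactorsList.length :=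
      Nat.eq_prime_pow_of_unique_prime_dvd k.den_nz fun {d} hd hdk => by
        by_contra h2
        exact (hd.coprime_iff_not_dvd.1 (h.coprime_den hd h2)) hdk
    have h3 : (k.den : ℚ) = 2 ^ k.den.primeFactorsList.length := by exact_mod_cast h2
    rw [← h3, mul_comm, Rat.mul_den_eq_num]
  · rintro ⟨n, m, h⟩ a b h1 h2
    have hnat : ∀ t : ℕ, RobinsonRel ℚ a b t := by
      intro t
      induction t with
      | zero => exact ⟨1, 0, 0, by simp⟩
      | succ t ih => exact_mod_cast h1 _ ih
    -- The relation involves only `k²`, so the sign of `m` is immaterial.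
    have hint : RobinsonRel ℚ a b m := by
      obtain ⟨x, y, z, hx⟩ := hnat m.natAbs
      refine ⟨x, y, z, ?_⟩
      rw [hx, Nat.cast_natAbs]
      simp
    rw [← h] at hint
    clear h
    induction n with
    | zero => simpa using hint
    | succ n ih =>
      apply ih
      apply h2
      rwa [← mul_assoc, ← pow_succ']

end

/-! ### Formulas read in two fields, and transfer from `ℚ` to `L` -/

section

open FirstOrder Language

attribute [local instance] FirstOrder.Ring.compatibleRingOfRing

/-- Two functions on two fields are given by a common term of the language of rings. -/
def SameTerm {α K K' : Type*} [Field K] [Field K'] (f : (α → K) → K) (f' : (α → K') → K') : Prop :=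
  ∃ t : Language.ring.Term α, (∀ v, t.realize v = f v) ∧ ∀ v, t.realize v = f' v

/-- Two predicates on two fields are given by a common formula of the language of rings. -/
def SameFormula {α K K' : Type*} [Field K] [Field K'] (P : (α → K) → Prop)
    (P' : (α → K') → Prop) : Prop :=
  ∃ φ : Language.ring.Formula α, (∀ v, φ.Realize v ↔ P v) ∧ ∀ v, φ.Realize v ↔ P' v

section

variable {α K K' : Type*} [Field K] [Field K']

namespace SameTerm

variable {f g : (α → K) → K} {f' g' : (α → K') → K'}

theorem var (a : α) : SameTerm (fun v : α → K => v a) (fun v : α → K' => v a) :=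
  ⟨Term.var a, fun _ => rfl, fun _ => rfl⟩

theorem add (hf : SameTerm f f') (hg : SameTerm g g') :
    SameTerm (fun v => f v + g v) (fun v => f' v + g' v) := by
  obtain ⟨s, hs, hs'⟩ := hf
  obtain ⟨t, ht, ht'⟩ := hg
  exact ⟨s + t, by simp [hs, ht], by simp [hs', ht']⟩

theorem mul (hf : SameTerm f f') (hg : SameTerm g g') :
    SameTerm (fun v => f v * g v) (fun v => f' v * g' v) := by
  obtain ⟨s, hs, hs'⟩ := hf
  obtain ⟨t, ht, ht'⟩ := hg
  exact ⟨s * t, by simp [hs, ht], by simp [hs', ht']⟩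

theorem neg (hf : SameTerm f f') : SameTerm (fun v => -f v) (fun v => -f' v) := by
  obtain ⟨s, hs, hs'⟩ := hf
  exact ⟨-s, by simp [hs], by simp [hs']⟩

theorem sub (hf : SameTerm f f') (hg : SameTerm g g') :
    SameTerm (fun v => f v - g v) (fun v => f' v - g' v) := by
  simpa only [sub_eq_add_neg] using hf.add hg.neg

theorem zero : SameTerm (fun _ : α → K => 0) (fun _ : α → K' => 0) :=
  ⟨0, by simp, by simp⟩

theorem one : SameTerm (fun _ : α → K => 1) (fun _ : α → K' => 1) :=
  ⟨1, by simp, by simp⟩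

theorem pow (hf : SameTerm f f') (k : ℕ) : SameTerm (fun v => f v ^ k) (fun v => f' v ^ k) := by
  induction k with
  | zero => simpa using one
  | succ k ih => simpa only [pow_succ] using ih.mul hf

theorem natCast (k : ℕ) : SameTerm (fun _ : α → K => (k : K)) (fun _ : α → K' => (k : K')) := by
  induction k with
  | zero => simpa using zero
  | succ k ih => simpa only [Nat.cast_succ] using ih.add one

theorem ofNat (k : ℕ) [k.AtLeastTwo] :
    SameTerm (fun _ : α → K => (OfNat.ofNat k : K)) (fun _ : α → K' => (OfNat.ofNat k : K')) :=
  natCast k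

theorem sum {ι : Type*} (s : Finset ι) {f : ι → (α → K) → K} {f' : ι → (α → K') → K'}
    (h : ∀ i, SameTerm (f i) (f' i)) :
    SameTerm (fun v => ∑ i ∈ s, f i v) (fun v => ∑ i ∈ s, f' i v) := by
  classical
  induction s using Finset.induction_on with
  | empty => simpa using zero
  | insert a s ha ih => simpa only [Finset.sum_insert ha] using (h a).add ih

theorem prod {ι : Type*} (s : Finset ι) {f : ι → (α → K) → K} {f' : ι → (α → K') → K'}
    (h : ∀ i, SameTerm (f i) (f' i)) :
    SameTerm (fun v => ∏ i ∈ s, f i v) (fun v => ∏ i ∈ s, f' i v) := by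
  classical
  induction s using Finset.induction_on with
  | empty => simpa using one
  | insert a s ha ih => simpa only [Finset.prod_insert ha] using (h a).mul ih

theorem weaken {β : Type*} (e : α → β) (hf : SameTerm f f') :
    SameTerm (fun v : β → K => f (fun a => v (e a))) (fun v : β → K' => f' (fun a => v (e a))) := by
  obtain ⟨s, hs, hs'⟩ := hf
  exact ⟨s.relabel e, fun v => by rw [Term.realize_relabel, hs]; rfl,
    fun v => by rw [Term.realize_relabel, hs']; rfl⟩

end SameTerm

namespace SameFormula

variable {P Q : (α → K) → Prop} {P' Q' : (α → K') → Prop}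

theorem eq {f g : (α → K) → K} {f' g' : (α → K') → K'} (hf : SameTerm f f') (hg : SameTerm g g') :
    SameFormula (fun v => f v = g v) (fun v => f' v = g' v) := by
  obtain ⟨s, hs, hs'⟩ := hf
  obtain ⟨t, ht, ht'⟩ := hg
  exact ⟨s.equal t, by simp [hs, ht], by simp [hs', ht']⟩

theorem not (hP : SameFormula P P') : SameFormula (fun v => ¬ P v) (fun v => ¬ P' v) := by
  obtain ⟨φ, hφ, hφ'⟩ := hP
  exact ⟨∼φ, by simp [hφ], by simp [hφ']⟩

theorem ne {f g : (α → K) → K} {f' g' : (α → K') → K'} (hf : SameTerm f f') (hg : SameTerm g g') :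
    SameFormula (fun v => f v ≠ g v) (fun v => f' v ≠ g' v) :=
  (eq hf hg).not

theorem imp (hP : SameFormula P P') (hQ : SameFormula Q Q') :
    SameFormula (fun v => P v → Q v) (fun v => P' v → Q' v) := by
  obtain ⟨φ, hφ, hφ'⟩ := hP
  obtain ⟨ψ, hψ, hψ'⟩ := hQ
  exact ⟨φ.imp ψ, by simp [hφ, hψ], by simp [hφ', hψ']⟩

theorem and (hP : SameFormula P P') (hQ : SameFormula Q Q') :
    SameFormula (fun v => P v ∧ Q v) (fun v => P' v ∧ Q' v) := by
  obtain ⟨φ, hφ, hφ'⟩ := hP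
  obtain ⟨ψ, hψ, hψ'⟩ := hQ
  exact ⟨φ ⊓ ψ, by simp [hφ, hψ], by simp [hφ', hψ']⟩

theorem or (hP : SameFormula P P') (hQ : SameFormula Q Q') :
    SameFormula (fun v => P v ∨ Q v) (fun v => P' v ∨ Q' v) := by
  obtain ⟨φ, hφ, hφ'⟩ := hP
  obtain ⟨ψ, hψ, hψ'⟩ := hQ
  exact ⟨φ ⊔ ψ, by simp [hφ, hψ], by simp [hφ', hψ']⟩

theorem ex {P : (α → K) → K → Prop} {P' : (α → K') → K' → Prop}
    (h : SameFormula (fun v : Option α → K => P (fun a => v (some a)) (v none))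
      (fun v : Option α → K' => P' (fun a => v (some a)) (v none))) :
    SameFormula (fun v => ∃ x, P v x) (fun v => ∃ x, P' v x) := by
  obtain ⟨φ, hφ, hφ'⟩ := h
  refine ⟨(φ.relabel fun a => a.elim (Sum.inr ()) Sum.inl).iExs Unit, fun v => ?_, fun v => ?_⟩
  all_goals
    simp only [Formula.realize_iExs, Formula.realize_relabel, hφ, hφ']
    exact ⟨fun ⟨i, hi⟩ => ⟨i (), hi⟩, fun ⟨x, hx⟩ => ⟨fun _ => x, hx⟩⟩

theorem all {P : (α → K) → K → Prop} {P' : (α → K') → K' → Prop}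
    (h : SameFormula (fun v : Option α → K => P (fun a => v (some a)) (v none))
      (fun v : Option α → K' => P' (fun a => v (some a)) (v none))) :
    SameFormula (fun v => ∀ x, P v x) (fun v => ∀ x, P' v x) := by
  simpa only [not_exists, not_not] using (SameFormula.ex (P := fun v x => ¬ P v x)
    (P' := fun v x => ¬ P' v x) h.not).not

end SameFormula

/-- Without free variables the common formula is a sentence, on which `ℚ` and `L` agree. Every use
of `L ⊨ Th(ℚ)` passes through here. -/
theorem SameFormula.transfer {L : Type*} [Field L]
    (hL : letI := fieldStructure L; theoryRat.Model L) {p p' : Prop}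
    (h : SameFormula (α := Empty) (K := ℚ) (K' := L) (fun _ => p) (fun _ => p')) : p ↔ p' := by
  obtain ⟨φ, hφ, hφ'⟩ := h
  have hmod : L ⊨ Language.ring.completeTheory ℚ := hL
  have h1 : L ⊨ φ ↔ ℚ ⊨ φ := (realize_iff_of_model_completeTheory ℚ L φ)
  unfold Sentence.Realize at h1
  exact (hφ _).symm.trans (h1.symm.trans (hφ' _))

theorem SameFormula.robinsonRel {f g h : (α → K) → K} {f' g' h' : (α → K') → K'}
    (hf : SameTerm f f') (hg : SameTerm g g') (hh : SameTerm h h') :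
    SameFormula (fun v => RobinsonRel K (f v) (g v) (h v))
      (fun v => RobinsonRel K' (f' v) (g' v) (h' v)) := by
  unfold RobinsonRel
  refine SameFormula.ex (SameFormula.ex (SameFormula.ex ?_))
  have e := fun {f f'} (hf : SameTerm (α := α) (K := K) (K' := K') f f') =>
    ((hf.weaken some).weaken some).weaken some
  exact .eq (.sub (.add (.pow (.var _) 2) (.mul (e hf) (.pow (.var _) 2)))
    (.mul (e hg) (.pow (.var _) 2)))
    (.add .one (.mul (.mul (e hf) (e hg)) (.pow (e hh) 2)))

theorem SameFormula.dyadicRel {f : (α → K) → K} {f' : (α → K') → K'} (hf : SameTerm f f') :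
    SameFormula (fun v => DyadicRel K (f v)) (fun v => DyadicRel K' (f' v)) := by
  unfold DyadicRel
  refine SameFormula.all (SameFormula.all (.imp (.all (.imp ?_ ?_)) (.imp (.all (.imp ?_ ?_)) ?_)))
  · exact .robinsonRel (.var _) (.var _) (.var _)
  · exact .robinsonRel (.var _) (.var _) (.add (.var _) .one)
  · exact .robinsonRel (.var _) (.var _) (.mul (.ofNat 2) (.var _))
  · exact .robinsonRel (.var _) (.var _) (.var _)
  · exact .robinsonRel (.var _) (.var _) ((hf.weaken some).weaken some)

end

end

/-! ### Powers of 2 and their exponents, first-order over `ℚ` -/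

section

open FirstOrder Language

/-- `x` is a sum of four squares. -/
def SumFourSq (K : Type*) [Field K] (x : K) : Prop :=
  ∃ a b c d : K, x = a ^ 2 + b ^ 2 + c ^ 2 + d ^ 2

/-- On `ℚ` this formula defines the group of powers of `2`. -/
def DyadicUnit (K : Type*) [Field K] (u : K) : Prop :=
  DyadicRel K u ∧ (∃ v, DyadicRel K v ∧ u * v = 1) ∧ SumFourSq K u

/-- Divisibility in the ring defined by `DyadicRel`. -/
def DyadicDvd (K : Type*) [Field K] (a b : K) : Prop := ∃ s, DyadicRel K s ∧ b = a * s

/-- `x - 1` is divisible by `y - 1` for each `y > 1` in `DyadicUnit` which is at most `w + w'`. -/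
def ManyDivisors (K : Type*) [Field K] (w w' x : K) : Prop :=
  ∀ y, DyadicUnit K y → y ≠ 1 → SumFourSq K (y - 1) → SumFourSq K (w + w' - y) →
    DyadicDvd K (y - 1) (x - 1)

section

variable {α K K' : Type*} [Field K] [Field K'] {f g h : (α → K) → K} {f' g' h' : (α → K') → K'}

theorem SameFormula.sumFourSq (hf : SameTerm f f') :
    SameFormula (fun v => SumFourSq K (f v)) (fun v => SumFourSq K' (f' v)) := by
  unfold SumFourSq
  exact .ex (.ex (.ex (.ex (.eq ((((hf.weaken some).weaken some).weaken some).weaken some)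
    (.add (.add (.add (.pow (.var _) 2) (.pow (.var _) 2)) (.pow (.var _) 2))
      (.pow (.var _) 2))))))

theorem SameFormula.dyadicUnit (hf : SameTerm f f') :
    SameFormula (fun v => DyadicUnit K (f v)) (fun v => DyadicUnit K' (f' v)) := by
  unfold DyadicUnit
  exact .and (.dyadicRel hf) (.and (.ex (.and (.dyadicRel (.var _))
    (.eq (.mul (hf.weaken some) (.var _)) .one))) (.sumFourSq hf))

theorem SameFormula.dyadicDvd (hf : SameTerm f f') (hg : SameTerm g g') :
    SameFormula (fun v => DyadicDvd K (f v) (g v)) (fun v => DyadicDvd K' (f' v) (g' v)) := by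
  unfold DyadicDvd
  exact .ex (.and (.dyadicRel (.var _)) (.eq (hg.weaken some) (.mul (hf.weaken some) (.var _))))

theorem SameFormula.manyDivisors (hf : SameTerm f f') (hg : SameTerm g g') (hh : SameTerm h h') :
    SameFormula (fun v => ManyDivisors K (f v) (g v) (h v))
      (fun v => ManyDivisors K' (f' v) (g' v) (h' v)) := by
  unfold ManyDivisors
  exact .all (.imp (.dyadicUnit (.var _)) (.imp (.ne (.var _) .one)
    (.imp (.sumFourSq (.sub (.var _) .one))
      (.imp (.sumFourSq (.sub (.add (hf.weaken some) (hg.weaken some)) (.var _)))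
        (.dyadicDvd (.sub (.var _) .one) (.sub (hh.weaken some) .one))))))

end

/-- Lagrange's theorem, applied to numerator times denominator; it makes the order of `ℚ` definable.
-/
theorem sumFourSq_rat_iff {x : ℚ} : SumFourSq ℚ x ↔ 0 ≤ x := by
  constructor
  · rintro ⟨a, b, c, d, rfl⟩
    positivity
  · intro hx
    obtain ⟨a, b, c, d, h⟩ := Nat.sum_four_squares (x.num.natAbs * x.den)
    have hd : (x.den : ℚ) ≠ 0 := by exact_mod_cast x.den_nz
    have hn : ((x.num.natAbs : ℕ) : ℚ) = x.num := by
      rw [Nat.cast_natAbs, abs_of_nonneg (Rat.num_nonneg.2 hx)]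
    have h' : (a : ℚ) ^ 2 + b ^ 2 + c ^ 2 + d ^ 2 = x * x.den * x.den := by
      rw [Rat.mul_den_eq_num, ← hn]
      exact_mod_cast h
    refine ⟨a / x.den, b / x.den, c / x.den, d / x.den, ?_⟩
    field_simp
    linear_combination -h'

theorem dyadicRel_intCast (m : ℤ) : DyadicRel ℚ m := dyadicRel_iff.2 ⟨0, m, by simp⟩

theorem dyadicRel_zpow_mul (i m : ℤ) : DyadicRel ℚ (2 ^ i * m) := by
  refine dyadicRel_iff.2 ⟨i.natAbs, 2 ^ (i.natAbs + i).toNat * m, ?_⟩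
  simp only [Int.cast_mul, Int.cast_pow, Int.cast_ofNat]
  rw [← mul_assoc, ← zpow_natCast, ← zpow_natCast, ← zpow_add₀ two_ne_zero,
    Int.toNat_of_nonneg (by lia)]

theorem DyadicRel.exists_zpow_mul {t : ℚ} (ht : DyadicRel ℚ t) (h0 : t ≠ 0) :
    ∃ (i m : ℤ), ¬ 2 ∣ m ∧ t = 2 ^ i * m := by
  obtain ⟨n, a, h⟩ := dyadicRel_iff.1 ht
  have ha : a ≠ 0 := by
    rintro rfl
    simp [h0] at h
  obtain ⟨m, hm, hm2⟩ := FiniteMultiplicity.exists_eq_pow_mul_and_not_dvd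
    (Int.finiteMultiplicity_iff.2 ⟨by decide, ha⟩ : FiniteMultiplicity 2 a)
  refine ⟨multiplicity 2 a - n, m, hm2, ?_⟩
  rw [hm] at h
  push_cast at h
  rw [zpow_sub₀ two_ne_zero, zpow_natCast, zpow_natCast, div_mul_eq_mul_div, ← h]
  field_simp

theorem zpow_mul_injective {i j m n : ℤ} (hm : ¬ 2 ∣ m) (hn : ¬ 2 ∣ n)
    (h : (2 : ℚ) ^ i * m = 2 ^ j * n) : i = j ∧ m = n := by
  wlog hij : i ≤ j generalizing i j m n
  · obtain ⟨h1, h2⟩ := this hn hm h.symm (by lia)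
    exact ⟨h1.symm, h2.symm⟩
  obtain ⟨k, rfl⟩ := Int.le.dest hij
  rw [zpow_add₀ two_ne_zero, mul_assoc] at h
  have h1 := mul_left_cancel₀ (by positivity) h
  rw [zpow_natCast] at h1
  have h2 : m = 2 ^ k * n := by exact_mod_cast h1
  cases k with
  | zero => simpa using h2
  | succ k => exact absurd ⟨2 ^ k * n, by rw [h2]; ring⟩ hm

theorem not_two_dvd_mul {m n : ℤ} (hm : ¬ 2 ∣ m) (hn : ¬ 2 ∣ n) : ¬ 2 ∣ m * n := fun h =>
  (Int.prime_two.dvd_or_dvd h).elim hm hn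

theorem dyadicUnit_rat_iff {u : ℚ} : DyadicUnit ℚ u ↔ ∃ i : ℤ, u = 2 ^ i := by
  constructor
  · rintro ⟨hu, ⟨v, hv, huv⟩, hs⟩
    obtain ⟨i, m, hm, rfl⟩ := hu.exists_zpow_mul (left_ne_zero_of_mul_eq_one huv)
    obtain ⟨j, k, hk, rfl⟩ := hv.exists_zpow_mul (right_ne_zero_of_mul_eq_one huv)
    have h1 : m * k = 1 := by
      refine (zpow_mul_injective (i := i + j) (j := 0) (not_two_dvd_mul hm hk)
        (by decide : ¬ (2 : ℤ) ∣ 1) ?_).2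
      rw [zpow_add₀ two_ne_zero]
      push_cast
      linear_combination huv
    rcases Int.eq_one_or_neg_one_of_mul_eq_one h1 with rfl | rfl
    · exact ⟨i, by simp⟩
    · have h2 := sumFourSq_rat_iff.1 hs
      have h3 : (0 : ℚ) < 2 ^ i := by positivity
      push_cast at h2
      linarith
  · rintro ⟨i, rfl⟩
    have h := fun i : ℤ => dyadicRel_zpow_mul i 1
    simp only [Int.cast_one, mul_one] at h
    refine ⟨h i, ⟨2 ^ (-i), h _, ?_⟩, sumFourSq_rat_iff.2 (by positivity)⟩
    rw [← zpow_add₀ two_ne_zero, add_neg_cancel, zpow_zero]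

theorem exists_dyadic_fraction (x : ℚ) :
    ∃ a b, DyadicRel ℚ a ∧ DyadicRel ℚ b ∧ b ≠ 0 ∧ x * b = a :=
  ⟨x.num, x.den, dyadicRel_intCast _, by exact_mod_cast dyadicRel_intCast x.den, by simp,
    Rat.mul_den_eq_num x⟩

theorem not_two_dvd_two_pow_sub_one {n : ℕ} (hn : n ≠ 0) : ¬ (2 : ℤ) ∣ 2 ^ n - 1 := by
  intro h
  have h2 : (2 : ℤ) ∣ 2 ^ n := dvd_pow_self 2 hn
  exact absurd ((dvd_sub_right h2).1 h) (by decide)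

/-- Euler's theorem for the odd part of `t`. The inverse `u'` is included because, after transfer, a
standard `u = 2 ^ i` may have a negative exponent. -/
theorem exists_dyadicUnit_dvd_sub_one (t : ℚ) (ht : DyadicRel ℚ t) (h0 : t ≠ 0) :
    ∃ u u', DyadicUnit ℚ u ∧ u * u' = 1 ∧ u ≠ 1 ∧ DyadicDvd ℚ t (u - 1) ∧
      DyadicDvd ℚ t (u' - 1) := by
  obtain ⟨i, m, hm, rfl⟩ := ht.exists_zpow_mul h0
  have hm0 : m ≠ 0 := by rintro rfl; simp at hm
  have hφ : 0 < Nat.totient m.natAbs := Nat.totient_pos.2 (Int.natAbs_pos.2 hm0)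
  set f := Nat.totient m.natAbs with hf
  have hcop : Nat.Coprime 2 m.natAbs := by
    rw [Nat.Prime.coprime_iff_not_dvd Nat.prime_two]
    intro h
    exact hm (Int.natCast_dvd.2 h)
  obtain ⟨s, hs⟩ : m ∣ 2 ^ f - 1 := by
    have h1 := (Int.natCast_modEq_iff.2 (Nat.ModEq.pow_totient hcop)).symm.dvd
    rw [← Int.natAbs_dvd]
    exact_mod_cast h1
  have hs' : (2 : ℚ) ^ f - 1 = m * s := by exact_mod_cast hs
  refine ⟨2 ^ f, 2 ^ (-(f : ℤ)), dyadicUnit_rat_iff.2 ⟨f, by simp⟩, ?_, ?_,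
    ⟨2 ^ (-i) * s, dyadicRel_zpow_mul _ _, ?_⟩, ⟨2 ^ (-i - f) * (-s : ℤ), dyadicRel_zpow_mul _ _, ?_⟩⟩
  · rw [zpow_neg, zpow_natCast, mul_inv_cancel₀ (by positivity)]
  · exact (one_lt_pow₀ (by norm_num) hφ.ne').ne'
  · rw [hs', zpow_neg]
    field_simp
  · rw [zpow_sub₀ two_ne_zero, zpow_neg, zpow_neg, zpow_natCast]
    push_cast
    field_simp
    linear_combination -hs'

/-- The odd part of a divisor of `M` in `ℤ[1/2]` is at most `M` in absolute value. For fixed `M` the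
vanishing product expresses `t * v ∈ {0, ±1, …, ±M}` in the language of rings. -/
theorem exists_dyadicUnit_mul_small {M : ℕ} (hM : M ≠ 0) (t s : ℚ) (ht : DyadicRel ℚ t)
    (hs : DyadicRel ℚ s) (h : t * s = M) :
    ∃ v, DyadicUnit ℚ v ∧ ∏ j ∈ Finset.range (M + 1), ((t * v) ^ 2 - (j : ℚ) ^ 2) = 0 := by
  have hM' : (M : ℚ) ≠ 0 := by exact_mod_cast hM
  obtain ⟨i, m, hm, rfl⟩ := ht.exists_zpow_mul (left_ne_zero_of_mul (h ▸ hM'))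
  obtain ⟨j, k, hk, rfl⟩ := hs.exists_zpow_mul (right_ne_zero_of_mul (h ▸ hM'))
  obtain ⟨e, N, hN, rfl⟩ := Nat.exists_eq_pow_mul_and_not_dvd hM 2 (by decide)
  have h1 : m * k = N := by
    refine (zpow_mul_injective (i := i + j) (j := e) (not_two_dvd_mul hm hk)
      (by exact_mod_cast hN) ?_).2
    rw [zpow_add₀ two_ne_zero, zpow_natCast]
    push_cast at h ⊢
    linear_combination h
  have h2 : m.natAbs ∣ N := by
    rw [← Int.natCast_dvd_natCast, Int.natAbs_dvd]
    exact ⟨k, h1.symm⟩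
  have h3 : m.natAbs < 2 ^ e * N + 1 := Nat.lt_succ_of_le (Nat.le_of_dvd
    (Nat.pos_of_ne_zero hM) (h2.mul_left _))
  refine ⟨2 ^ (-i), dyadicUnit_rat_iff.2 ⟨_, rfl⟩,
    Finset.prod_eq_zero (Finset.mem_range.2 h3) ?_⟩
  rw [zpow_neg, Nat.cast_natAbs]
  push_cast
  rw [sq_abs]
  field_simp
  ring

theorem exists_manyDivisors (w w' : ℚ) (hw : DyadicUnit ℚ w) (hww : w * w' = 1) :
    ∃ x, DyadicUnit ℚ x ∧ x ≠ 1 ∧ ManyDivisors ℚ w w' x := by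
  obtain ⟨i, rfl⟩ := dyadicUnit_rat_iff.1 hw
  obtain rfl : w' = 2 ^ (-i) := by rw [zpow_neg]; exact eq_inv_of_mul_eq_one_right hww
  -- The sum `w + w'` is symmetric in the sign of `i` and at most `2 ^ (|i| + 1)`, so only exponents
  -- `j ≤ J` occur, and each divides `J !`.
  set J := i.natAbs + 1 with hJ
  have hf := Nat.factorial_pos J
  refine ⟨2 ^ J.factorial, dyadicUnit_rat_iff.2 ⟨J.factorial, by simp⟩,
    (one_lt_pow₀ (by norm_num) hf.ne').ne', ?_⟩
  intro y hy hy1 hge hle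
  obtain ⟨j, rfl⟩ := dyadicUnit_rat_iff.1 hy
  rw [sumFourSq_rat_iff, sub_nonneg] at hge hle
  have hj : 0 ≤ j := by
    by_contra h
    exact absurd hge (not_le.2 (zpow_lt_one_of_neg₀ (by norm_num) (by lia)))
  lift j to ℕ using hj
  rw [zpow_natCast] at hge hle hy1 ⊢
  have hjJ : j ≤ J := by
    have hb : ∀ k : ℤ, k ≤ i.natAbs → (2 : ℚ) ^ k ≤ 2 ^ i.natAbs := fun k hk => by
      rw [← zpow_natCast]
      exact zpow_le_zpow_right₀ (by norm_num) hk
    have h1 := hb i (by lia)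
    have h2 := hb (-i) (by lia)
    refine (pow_le_pow_iff_right₀ (a := (2 : ℚ)) (by norm_num)).1 ?_
    rw [hJ, pow_succ]
    linarith
  have hj0 : 0 < j := by
    rcases Nat.eq_zero_or_pos j with rfl | h
    · simp at hy1
    · exact h
  obtain ⟨k, hk⟩ := Nat.dvd_factorial hj0 hjJ
  obtain ⟨s, hs⟩ : (2 ^ j - 1 : ℤ) ∣ 2 ^ J.factorial - 1 := by
    rw [hk, pow_mul]
    simpa using sub_dvd_pow_sub_pow ((2 : ℤ) ^ j) 1 k
  exact ⟨s, dyadicRel_intCast s, by exact_mod_cast hs⟩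

/-- Since `2 ^ m - 1` and `2 ^ |k| - 1` are odd, divisibility in `ℤ[1/2]` is divisibility in `ℤ`;
then `gcd(2 ^ m - 1, 2 ^ |k| - 1) = 2 ^ gcd(m, |k|) - 1` gives `m ∣ k`. -/
theorem exists_pow_eq_of_dyadicDvd {m : ℕ} (hm : m ≠ 0) {k : ℤ}
    (h : DyadicDvd ℚ (2 ^ m - 1) (2 ^ k - 1)) : ∃ z : ℚ, 2 ^ k = z ^ m := by
  suffices hmk : (m : ℤ) ∣ k by
    obtain ⟨l, rfl⟩ := hmk
    exact ⟨2 ^ l, by rw [← zpow_natCast, ← zpow_mul, mul_comm]⟩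
  obtain ⟨s, hs, h⟩ := h
  by_cases hs0 : s = 0
  · rw [hs0, mul_zero, sub_eq_zero, zpow_eq_one_iff_right₀ (by norm_num) (by norm_num)] at h
    simp [h]
  obtain ⟨j, c, hc, rfl⟩ := hs.exists_zpow_mul hs0
  by_cases hk0 : k = 0
  · simp [hk0]
  have hkn : k.natAbs ≠ 0 := by simpa using hk0
  have key : (2 ^ m - 1 : ℤ) ∣ 2 ^ k.natAbs - 1 := by
    rcases Int.natAbs_eq k with hk | hk
    · have := (zpow_mul_injective (i := j) (j := 0) (m := (2 ^ m - 1) * c)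
        (n := 2 ^ k.natAbs - 1) (not_two_dvd_mul (not_two_dvd_two_pow_sub_one hm) hc)
        (not_two_dvd_two_pow_sub_one hkn) ?_).2
      · exact ⟨c, this.symm⟩
      · rw [hk, zpow_natCast] at h
        push_cast
        linear_combination -h
    · have := (zpow_mul_injective (i := j) (j := -k.natAbs) (m := (2 ^ m - 1) * -c)
        (n := 2 ^ k.natAbs - 1) (not_two_dvd_mul (not_two_dvd_two_pow_sub_one hm) (by rwa [dvd_neg]))
        (not_two_dvd_two_pow_sub_one hkn) ?_).2
      · exact ⟨-c, this.symm⟩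
      · rw [hk] at h
        simp only [Int.cast_mul, Int.cast_sub, Int.cast_pow, Int.cast_ofNat, Int.cast_one,
          Int.cast_neg]
        rw [mul_sub, zpow_neg, zpow_natCast, inv_mul_cancel₀ (by positivity)]
        rw [zpow_neg, zpow_natCast] at h
        linear_combination h
  have key' : 2 ^ m - 1 ∣ 2 ^ k.natAbs - 1 := by
    zify
    rw [Nat.cast_sub Nat.one_le_two_pow, Nat.cast_sub Nat.one_le_two_pow]
    exact_mod_cast key
  have h1 := Nat.pow_sub_one_gcd_pow_sub_one 2 m k.natAbs
  rw [Nat.gcd_eq_left key'] at h1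
  have h2 : 2 ^ m = 2 ^ m.gcd k.natAbs := by
    have := Nat.one_le_two_pow (n := m)
    have := Nat.one_le_two_pow (n := m.gcd k.natAbs)
    lia
  have h3 := Nat.pow_right_injective le_rfl h2
  rw [Int.natCast_dvd]
  exact Nat.gcd_eq_left_iff_dvd.1 h3.symm

/-- If `w = 2 ^ i` with `|i| > m`, then `2 ^ m ≤ w + w'` and `y = 2 ^ m` is an admissible divisor.
The product lists the finitely many exceptional `w`, and a nonstandard `w` avoids them for every
`m`. -/
theorem exists_pow_eq_of_manyDivisors {m : ℕ} (hm : m ≠ 0) (w w' x : ℚ) (hw : DyadicUnit ℚ w)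
    (hww : w * w' = 1) (hx : DyadicUnit ℚ x) (h : ManyDivisors ℚ w w' x) :
    (∃ z, x = z ^ m) ∨ ∏ j ∈ Finset.range (m + 1), ((w - 2 ^ j) * (2 ^ j * w - 1)) = 0 := by
  obtain ⟨i, rfl⟩ := dyadicUnit_rat_iff.1 hw
  obtain rfl : w' = 2 ^ (-i) := by rw [zpow_neg]; exact eq_inv_of_mul_eq_one_right hww
  obtain ⟨k, rfl⟩ := dyadicUnit_rat_iff.1 hx
  by_cases him : i.natAbs < m + 1
  · right
    refine Finset.prod_eq_zero (Finset.mem_range.2 him) ?_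
    rcases Int.natAbs_eq i with hi | hi
    · nth_rw 1 [hi]
      rw [zpow_natCast, sub_self, zero_mul]
    · nth_rw 4 [hi]
      rw [zpow_neg, zpow_natCast, mul_inv_cancel₀ (by positivity), sub_self, mul_zero]
  · left
    apply exists_pow_eq_of_dyadicDvd hm
    have hlt : (1 : ℚ) < 2 ^ m := one_lt_pow₀ (by norm_num) hm
    refine h _ (dyadicUnit_rat_iff.2 ⟨m, by simp⟩) hlt.ne'
      (sumFourSq_rat_iff.2 (by linarith)) (sumFourSq_rat_iff.2 ?_)
    have hi : (2 : ℚ) ^ m ≤ 2 ^ (i.natAbs : ℤ) := by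
      rw [zpow_natCast]
      exact pow_le_pow_right₀ (by norm_num) (by lia)
    have h1 : (0 : ℚ) < 2 ^ i := by positivity
    have h2 : (0 : ℚ) < 2 ^ (-i) := by positivity
    rcases Int.natAbs_eq i with hi' | hi'
    · rw [← hi'] at hi
      linarith
    · rw [show (i.natAbs : ℤ) = -i by lia] at hi
      linarith

end

/-! ### A nontrivial divisible subgroup of `Lˣ` -/

section

open FirstOrder Language

section

variable {L : Type*} [Field L]

theorem charZero_of_model (hL : letI := fieldStructure L; theoryRat.Model L) : CharZero L := by
  refine charZero_of_inj_zero fun n hn => ?_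
  have h : (n : ℚ) = 0 := by
    refine (SameFormula.transfer hL ?_).2 hn
    exact .eq (.natCast n) .zero
  exact_mod_cast h

theorem sq_eq_sq_of_model (hL : letI := fieldStructure L; theoryRat.Model L) {m : ℕ} (hm : m ≠ 0)
    (x y : L) (h : x ^ m = y ^ m) : x ^ 2 = y ^ 2 := by
  have hrat : ∀ x y : ℚ, x ^ m = y ^ m → x ^ 2 = y ^ 2 := fun x y h => by
    rw [sq_eq_sq_iff_abs_eq_abs]
    refine (pow_left_inj₀ (abs_nonneg x) (abs_nonneg y) hm).1 ?_
    rw [← abs_pow, h, abs_pow]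
  revert x y
  refine (SameFormula.transfer hL ?_).1 hrat
  exact .all (.all (.imp (.eq (.pow (.var _) m) (.pow (.var _) m))
    (.eq (.pow (.var _) 2) (.pow (.var _) 2))))

theorem sq_ne_neg_one_of_model (hL : letI := fieldStructure L; theoryRat.Model L) (x : L) :
    x ^ 2 ≠ -1 := by
  revert x
  refine (SameFormula.transfer hL ?_).1 (fun x : ℚ => (by nlinarith [sq_nonneg x] : x ^ 2 ≠ -1))
  exact .all (.ne (.pow (.var _) 2) (.neg .one))

/-- Some `t` in the dyadic ring of `L` is not rational. If its Euler unit `u` is a standard power of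
2, then `t` divides a standard integer, so `t * v` is a standard integer for some unit `v`; this `v`
cannot be standard. -/
theorem exists_nonstandard_dyadicUnit (hL : letI := fieldStructure L; theoryRat.Model L)
    (hne : IsEmpty (L ≃+* ℚ)) :
    ∃ w : L, DyadicUnit L w ∧ ∀ i : ℤ, w ≠ 2 ^ i := by
  have := charZero_of_model hL
  obtain ⟨x, hx⟩ : ∃ x : L, ∀ q : ℚ, (q : L) ≠ x := by
    by_contra! h
    exact hne.false (RingEquiv.ofBijective (Rat.castHom L) ⟨(Rat.castHom L).injective, h⟩).symm
  have fraction : ∀ x : L, ∃ a b, DyadicRel L a ∧ DyadicRel L b ∧ b ≠ 0 ∧ x * b = a := by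
    refine (SameFormula.transfer hL ?_).1 exists_dyadic_fraction
    exact .all (.ex (.ex (.and (.dyadicRel (.var _)) (.and (.dyadicRel (.var _))
      (.and (.ne (.var _) .zero) (.eq (.mul (.var _) (.var _)) (.var _)))))))
  obtain ⟨t, ht, htx⟩ : ∃ t : L, DyadicRel L t ∧ ∀ q : ℚ, (q : L) ≠ t := by
    obtain ⟨a, b, ha, hb, hb0, hab⟩ := fraction x
    by_contra! h
    obtain ⟨q, rfl⟩ := h a ha
    obtain ⟨r, rfl⟩ := h b hb
    refine hx (q / r) ?_
    rw [Rat.cast_div, ← hab, mul_div_cancel_right₀ _ hb0]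
  have euler : ∀ t : L, DyadicRel L t → t ≠ 0 → ∃ u u', DyadicUnit L u ∧ u * u' = 1 ∧ u ≠ 1 ∧
      DyadicDvd L t (u - 1) ∧ DyadicDvd L t (u' - 1) := by
    refine (SameFormula.transfer hL ?_).1 exists_dyadicUnit_dvd_sub_one
    exact .all (.imp (.dyadicRel (.var _)) (.imp (.ne (.var _) .zero) (.ex (.ex
      (.and (.dyadicUnit (.var _)) (.and (.eq (.mul (.var _) (.var _)) .one)
      (.and (.ne (.var _) .one) (.and (.dyadicDvd (.var _) (.sub (.var _) .one))
      (.dyadicDvd (.var _) (.sub (.var _) .one))))))))))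
  obtain ⟨u, u', hu, huu, hu1, hd, hd'⟩ := euler t ht fun h => htx 0 (by simp [h])
  by_cases hstd : ∀ i : ℤ, u ≠ 2 ^ i
  · exact ⟨u, hu, hstd⟩
  push Not at hstd
  obtain ⟨i, rfl⟩ := hstd
  have hu' : u' = 2 ^ (-i) := by rw [zpow_neg]; exact eq_inv_of_mul_eq_one_right huu
  obtain ⟨s, hs, hts⟩ : DyadicDvd L t (2 ^ i.natAbs - 1) := by
    rcases Int.natAbs_eq i with hi | hi
    · rwa [hi, zpow_natCast] at hd
    · rwa [hu', show -i = (i.natAbs : ℤ) by lia, zpow_natCast] at hd'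
  have hi0 : i.natAbs ≠ 0 := by
    intro h
    apply hu1
    rw [Int.natAbs_eq_zero.1 h, zpow_zero]
  have hM : 2 ^ i.natAbs - 1 ≠ 0 := (Nat.sub_pos_of_lt (Nat.one_lt_two_pow hi0)).ne'
  have small : ∀ t s : L, DyadicRel L t → DyadicRel L s → t * s = (2 ^ i.natAbs - 1 : ℕ) →
      ∃ v, DyadicUnit L v ∧
        ∏ j ∈ Finset.range (2 ^ i.natAbs - 1 + 1), ((t * v) ^ 2 - (j : L) ^ 2) = 0 := by
    refine (SameFormula.transfer hL ?_).1 (exists_dyadicUnit_mul_small hM)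
    exact .all (.all (.imp (.dyadicRel (.var _)) (.imp (.dyadicRel (.var _)) (.imp
      (.eq (.mul (.var _) (.var _)) (.natCast _)) (.ex (.and (.dyadicUnit (.var _)) (.eq
      (.prod _ fun j => .sub (.pow (.mul (.var _) (.var _)) 2) (.pow (.natCast j) 2)) .zero)))))))
  obtain ⟨v, hv, hprod⟩ := small t s ht hs (by
    rw [← hts, Nat.cast_sub Nat.one_le_two_pow]
    push_cast
    rfl)
  refine ⟨v, hv, ?_⟩
  rintro k rfl
  obtain ⟨j, -, hj⟩ := Finset.prod_eq_zero_iff.1 hprod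
  have h2 : (2 : L) ^ k ≠ 0 := zpow_ne_zero _ two_ne_zero
  rcases sq_eq_sq_iff_eq_or_eq_neg.1 (sub_eq_zero.1 hj) with h | h
  · refine htx (j / 2 ^ k) ?_
    push_cast
    rw [← h, mul_div_cancel_right₀ _ h2]
  · refine htx (-j / 2 ^ k) ?_
    push_cast
    rw [← h, mul_div_cancel_right₀ _ h2]

theorem exists_ne_one_forall_exists_pow_eq (hL : letI := fieldStructure L; theoryRat.Model L)
    (hne : IsEmpty (L ≃+* ℚ)) :
    ∃ x : L, x ≠ 0 ∧ x ≠ 1 ∧ ∀ m : ℕ, m ≠ 0 → ∃ z, x = z ^ m := by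
  obtain ⟨w, hw, hstd⟩ := exists_nonstandard_dyadicUnit hL hne
  have many : ∀ w w' : L, DyadicUnit L w → w * w' = 1 →
      ∃ x, DyadicUnit L x ∧ x ≠ 1 ∧ ManyDivisors L w w' x := by
    refine (SameFormula.transfer hL ?_).1 exists_manyDivisors
    exact .all (.all (.imp (.dyadicUnit (.var _)) (.imp (.eq (.mul (.var _) (.var _)) .one)
      (.ex (.and (.dyadicUnit (.var _)) (.and (.ne (.var _) .one)
      (.manyDivisors (.var _) (.var _) (.var _))))))))
  obtain ⟨w', -, hww⟩ := hw.2.1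
  obtain ⟨x, hx, hx1, hmd⟩ := many w w' hw hww
  obtain ⟨v, -, hxv⟩ := hx.2.1
  refine ⟨x, left_ne_zero_of_mul_eq_one hxv, hx1, fun m hm => ?_⟩
  have root : ∀ w w' x : L, DyadicUnit L w → w * w' = 1 → DyadicUnit L x →
      ManyDivisors L w w' x →
      (∃ z, x = z ^ m) ∨ ∏ j ∈ Finset.range (m + 1), ((w - 2 ^ j) * (2 ^ j * w - 1)) = 0 := by
    refine (SameFormula.transfer hL ?_).1 (exists_pow_eq_of_manyDivisors hm)
    exact .all (.all (.all (.imp (.dyadicUnit (.var _)) (.imp (.eq (.mul (.var _) (.var _)) .one)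
      (.imp (.dyadicUnit (.var _)) (.imp (.manyDivisors (.var _) (.var _) (.var _))
      (.or (.ex (.eq (.var _) (.pow (.var _) m))) (.eq (.prod _ fun j =>
        .mul (.sub (.var _) (.pow (.ofNat 2) j)) (.sub (.mul (.pow (.ofNat 2) j) (.var _)) .one))
        .zero))))))))
  refine (root w w' x hw hww hx hmd).resolve_right fun h => ?_
  obtain ⟨j, -, hj⟩ := Finset.prod_eq_zero_iff.1 h
  rcases mul_eq_zero.1 hj with h | h
  · exact hstd j (by rw [zpow_natCast]; exact sub_eq_zero.1 h)
  · refine hstd (-j) ?_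
    rw [zpow_neg, zpow_natCast]
    exact eq_inv_of_mul_eq_one_right (sub_eq_zero.1 h)

/-- The only roots of unity in `L` are `±1`, and `-1`, not being a square, lies in no divisible
subgroup. -/
theorem isMulTorsionFree_of_isDivisibleGroup (hL : letI := fieldStructure L; theoryRat.Model L)
    (D : Subgroup Lˣ) (hD : IsDivisibleGroup D) : IsMulTorsionFree D := by
  have key : ∀ m : ℕ, m ≠ 0 → ∀ d : D, d ^ m = 1 → d = 1 := by
    intro m hm d hd
    have h1 : ((d : Lˣ) : L) ^ m = 1 ^ m := by
      rw [one_pow, ← Units.val_pow_eq_pow_val, ← Subgroup.coe_pow, hd]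
      simp
    have h2 := sq_eq_sq_of_model hL hm _ _ h1
    rcases sq_eq_sq_iff_eq_or_eq_neg.1 h2 with h | h
    · exact Subtype.ext (Units.ext h)
    · obtain ⟨e, rfl⟩ := hD 2 (by norm_num) d
      exact absurd (by simpa using h) (sq_ne_neg_one_of_model hL ((e : Lˣ) : L))
  refine ⟨fun n hn x y hxy => ?_⟩
  have h := key n hn (x * y⁻¹) (by
    have hxy' : x ^ n = y ^ n := hxy
    rw [mul_pow, hxy', ← mul_pow, mul_inv_cancel, one_pow])
  exact mul_inv_eq_one.1 h

theorem exists_divisible_subgroup (hL : letI := fieldStructure L; theoryRat.Model L)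
    (hne : IsEmpty (L ≃+* ℚ)) : ∃ D : Subgroup Lˣ, D ≠ ⊥ ∧ IsDivisibleGroup D := by
  let D : Subgroup Lˣ :=
    { carrier := {x | ∀ m : ℕ, m ≠ 0 → ∃ z, x = z ^ m}
      mul_mem' := fun {a b} ha hb m hm => by
        obtain ⟨x, rfl⟩ := ha m hm
        obtain ⟨y, rfl⟩ := hb m hm
        exact ⟨x * y, (mul_pow x y m).symm⟩
      one_mem' := fun m _ => ⟨1, (one_pow m).symm⟩
      inv_mem' := fun {a} ha m hm => by
        obtain ⟨x, rfl⟩ := ha m hm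
        exact ⟨x⁻¹, (inv_pow x m).symm⟩ }
  refine ⟨D, ?_, ?_⟩
  · obtain ⟨x, hx0, hx1, hx⟩ := exists_ne_one_forall_exists_pow_eq hL hne
    intro hbot
    have hmem : Units.mk0 x hx0 ∈ D := fun m hm => by
      obtain ⟨z, hz⟩ := hx m hm
      have hz0 : z ≠ 0 := by
        rintro rfl
        exact hx0 (by rw [hz, zero_pow hm])
      exact ⟨Units.mk0 z hz0, Units.ext (by simpa using hz)⟩
    rw [hbot, Subgroup.mem_bot, Units.ext_iff] at hmem
    exact hx1 hmem
  · rintro m hm ⟨d, hd⟩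
    -- A root of order `2m` is taken because only squares of roots are unique: `z ^ (2m) = (w ^ k) ^
    -- (2m)` gives `z² = (w²) ^ k`, so `z²` is an `m`-th root of `d` that has all roots itself.
    obtain ⟨z, hz⟩ := hd (2 * m) (by lia)
    refine ⟨⟨z ^ 2, fun k hk => ?_⟩, Subtype.ext ?_⟩
    · obtain ⟨w, hw⟩ := hd (2 * m * k) (by positivity)
      refine ⟨w ^ 2, ?_⟩
      have h : (z : L) ^ (2 * m) = ((w : L) ^ k) ^ (2 * m) := by
        rw [← pow_mul, mul_comm k]
        exact_mod_cast congrArg Units.val (hz.symm.trans hw)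
      have h2 := sq_eq_sq_of_model hL (by lia) _ _ h
      apply Units.ext
      push_cast
      rw [h2, ← pow_mul, ← pow_mul, mul_comm]
    · change (z ^ 2) ^ m = d
      rw [← pow_mul, hz]

end

end

/-! ### Elementary equivalence of direct products -/

section

open FirstOrder Language

attribute [local instance] groupStructure

namespace GroupElemEquiv

variable {G H K : Type*} [Group G] [Group H] [Group K]

theorem symm (h : GroupElemEquiv G H) : GroupElemEquiv H G :=
  ElementarilyEquivalent.symm h

theorem trans (h : GroupElemEquiv G H) (h' : GroupElemEquiv H K) : GroupElemEquiv G K :=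
  ElementarilyEquivalent.trans h h'

theorem of_mulEquiv (e : G ≃* H) : GroupElemEquiv G H := by
  let f : G ≃[groupLanguage] H :=
    { toEquiv := e.toEquiv
      map_fun' := fun {n} f x => by
        cases f
        · exact map_mul e _ _
        · exact map_inv e _
        · exact map_one e
      map_rel' := fun r => r.elim }
  exact f.toElementaryEmbedding.elementarilyEquivalent

end GroupElemEquiv

theorem realize_term_prod {A D : Type*} [Group A] [Group D] {n : ℕ} (g : Fin n → A)
    (d : Fin n → D) (t : groupLanguage.Term (Empty ⊕ Fin n)) :
    t.realize (M := A × D) (Sum.elim default fun i => (g i, d i)) =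
      (t.realize (Sum.elim default g), t.realize (Sum.elim default d)) := by
  induction t with
  | var a => rcases a with a | a <;> first | exact a.elim | rfl
  | func f ts ih =>
    simp only [Term.realize, ih]
    cases f <;> rfl

open Classical in
/-- The formula saying that the set of true formulas of a finite family is `S` for some value of the
last variable. -/
noncomputable def existsTruthSet {ι : Type} [Finite ι] {n : ℕ}
    (ψ : ι → groupLanguage.BoundedFormula Empty (n + 1)) (S : Set ι) :
    groupLanguage.BoundedFormula Empty n :=
  (BoundedFormula.iInf fun i => if i ∈ S then ψ i else ∼(ψ i)).ex

theorem realize_existsTruthSet {ι : Type} [Finite ι] {n : ℕ}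
    (ψ : ι → groupLanguage.BoundedFormula Empty (n + 1)) (S : Set ι) {A : Type*} [Group A]
    (g : Fin n → A) : (existsTruthSet ψ S).Realize default g ↔
      ∃ a : A, {i | (ψ i).Realize default (Fin.snoc g a)} = S := by
  classical
  simp only [existsTruthSet, BoundedFormula.realize_ex, BoundedFormula.realize_iInf]
  refine exists_congr fun a => ?_
  rw [Set.ext_iff]
  refine forall_congr' fun i => ?_
  by_cases hi : i ∈ S <;> simp [hi]

theorem snoc_prodMk {A D : Type*} {n : ℕ} (g : Fin n → A) (d : Fin n → D) (a : A) (e : D) :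
    (Fin.snoc (fun i => (g i, d i)) (a, e) : Fin (n + 1) → A × D) =
      fun i => ((Fin.snoc g a : Fin (n + 1) → A) i, (Fin.snoc d e : Fin (n + 1) → D) i) := by
  funext i
  refine Fin.lastCases ?_ (fun j => ?_) i <;> simp

/-- Truth of a formula in a product of two groups depends only on the truth of finitely many formulas
in the first factor. -/
theorem exists_truth_vector {G G' D : Type*} [Group G] [Group G'] [Group D] {m : ℕ}
    (φ : groupLanguage.BoundedFormula Empty m) :
    ∃ (ι : Type) (_ : Finite ι) (ψ : ι → groupLanguage.BoundedFormula Empty m)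
      (F : Set ι → (Fin m → D) → Prop),
      (∀ (g : Fin m → G) (d : Fin m → D), φ.Realize (M := G × D) default (fun i => (g i, d i)) ↔
        F {i | (ψ i).Realize default g} d) ∧
      ∀ (g : Fin m → G') (d : Fin m → D), φ.Realize (M := G' × D) default (fun i => (g i, d i)) ↔
        F {i | (ψ i).Realize default g} d := by
  induction φ with
  | falsum => exact ⟨Empty, inferInstance, Empty.elim, fun _ _ => False, fun _ _ => Iff.rfl, fun _ _ => Iff.rfl⟩
  | @equal n s t =>
    refine ⟨Unit, inferInstance, fun _ => .equal s t, fun S d => () ∈ S ∧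
      s.realize (Sum.elim default d) = t.realize (Sum.elim default d), ?_, ?_⟩
    all_goals
      intro g d
      simp only [BoundedFormula.Realize, realize_term_prod, Prod.mk.injEq, Set.mem_ofPred]
  | rel r => exact r.elim
  | imp φ₁ φ₂ ih₁ ih₂ =>
    obtain ⟨ι₁, _, ψ₁, F₁, h₁, h₁'⟩ := ih₁
    obtain ⟨ι₂, _, ψ₂, F₂, h₂, h₂'⟩ := ih₂
    refine ⟨ι₁ ⊕ ι₂, inferInstance, Sum.elim ψ₁ ψ₂,
      fun S d => F₁ (Sum.inl ⁻¹' S) d → F₂ (Sum.inr ⁻¹' S) d, fun g d => ?_, fun g d => ?_⟩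
    · simp only [BoundedFormula.realize_imp, h₁, h₂]
      rfl
    · simp only [BoundedFormula.realize_imp, h₁', h₂']
      rfl
  | @all n φ ih =>
    obtain ⟨ι, _, ψ, F, h, h'⟩ := ih
    -- For a quantified pair `(a, e)`, only the family of truth sets attained by elements `a`
    -- matters. It is recorded by one formula for each subset of `ι`.
    refine ⟨Set ι, inferInstance, existsTruthSet ψ, fun T d => ∀ S ∈ T, ∀ e, F S (Fin.snoc d e), ?_, ?_⟩
    all_goals
      intro g d
      simp only [BoundedFormula.realize_all, Prod.forall, snoc_prodMk, h, h', Set.mem_ofPred,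
        realize_existsTruthSet]
      exact ⟨fun H S ⟨a, ha⟩ e => ha ▸ H a e, fun H a e => H _ ⟨a, rfl⟩ e⟩

theorem GroupElemEquiv.prod_right {G G' : Type*} [Group G] [Group G'] (h : GroupElemEquiv G G')
    (D : Type*) [Group D] : GroupElemEquiv (G × D) (G' × D) := by
  refine elementarilyEquivalent_iff.2 fun φ => ?_
  obtain ⟨ι, _, ψ, F, h₁, h₁'⟩ := exists_truth_vector (G := G) (G' := G') (D := D) φ
  have hψ : {i | (ψ i).Realize (M := G) default default} =
      {i | (ψ i).Realize (M := G') default default} :=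
    Set.ext fun i => elementarilyEquivalent_iff.1 h (ψ i)
  have e₁ := h₁ default default
  rw [hψ, ← h₁' default default] at e₁
  convert e₁ using 1 <;>
  · unfold Sentence.Realize Formula.Realize
    congr!

end

/-! ### Interpreting `GL_n(K)` in `K` -/

section

open FirstOrder Language

attribute [local instance] groupStructure
attribute [local instance] FirstOrder.Ring.compatibleRingOfRing

namespace SameFormula

variable {α β K K' : Type*} [Field K] [Field K']

theorem relabel {P : (α → K) → Prop} {P' : (α → K') → Prop} (e : α → β) (h : SameFormula P P') :
    SameFormula (fun v : β → K => P fun a => v (e a)) (fun v : β → K' => P' fun a => v (e a)) := by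
  obtain ⟨φ, hφ, hφ'⟩ := h
  exact ⟨φ.relabel e, fun v => by rw [Formula.realize_relabel, hφ]; rfl,
    fun v => by rw [Formula.realize_relabel, hφ']; rfl⟩

theorem forall_finite {ι : Type*} [Finite ι] {P : ι → (α → K) → Prop}
    {P' : ι → (α → K') → Prop} (h : ∀ i, SameFormula (P i) (P' i)) :
    SameFormula (fun v => ∀ i, P i v) (fun v => ∀ i, P' i v) := by
  choose φ hφ hφ' using h
  exact ⟨Formula.iInf φ, by simp [hφ], by simp [hφ']⟩

theorem all_tuple [Finite β] {P : (α → K) → (β → K) → Prop} {P' : (α → K') → (β → K') → Prop}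
    (h : SameFormula (fun v : α ⊕ β → K => P (fun a => v (Sum.inl a)) (fun b => v (Sum.inr b)))
      (fun v : α ⊕ β → K' => P' (fun a => v (Sum.inl a)) (fun b => v (Sum.inr b)))) :
    SameFormula (fun v => ∀ x, P v x) (fun v => ∀ x, P' v x) := by
  obtain ⟨φ, hφ, hφ'⟩ := h
  exact ⟨φ.iAlls β, by simp [hφ], by simp [hφ']⟩

end SameFormula

open Matrix

section

variable {n : ℕ} {K K' : Type*} [Field K] [Field K']

/-- The entries of an invertible matrix (for `true`) and of its inverse (for `false`). -/
def glEntry (A : GL (Fin n) K) (p : Bool × Fin n × Fin n) : K :=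
  (if p.1 then A else A⁻¹ : GL (Fin n) K).1 p.2.1 p.2.2

/-- The entries of a tuple of invertible matrices and of their inverses. -/
def glEntries {m : ℕ} (g : Fin m → GL (Fin n) K) (p : Fin m × Bool × Fin n × Fin n) : K :=
  glEntry (g p.1) p.2

theorem glEntry_injective : Function.Injective (glEntry : GL (Fin n) K → _) := fun _ _ h =>
  Units.ext (Matrix.ext fun i j => congrFun h (true, i, j))

theorem glEntry_mul (A B : GL (Fin n) K) (p : Bool × Fin n × Fin n) :
    glEntry (A * B) p = ∑ k, glEntry (if p.1 then A else B) (p.1, p.2.1, k) *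
      glEntry (if p.1 then B else A) (p.1, k, p.2.2) := by
  obtain ⟨b, i, j⟩ := p
  cases b
  · simp [glEntry, _root_.mul_inv_rev, Matrix.mul_apply]
  · simp [glEntry, Matrix.mul_apply]

theorem glEntry_inv (A : GL (Fin n) K) (p : Bool × Fin n × Fin n) :
    glEntry A⁻¹ p = glEntry A (!p.1, p.2) := by
  obtain ⟨b, i, j⟩ := p
  cases b <;> simp [glEntry]

theorem glEntry_one (p : Bool × Fin n × Fin n) :
    glEntry (1 : GL (Fin n) K) p = if p.2.1 = p.2.2 then 1 else 0 := by
  simp [glEntry, Matrix.one_apply]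

/-- `x` lists the entries of two mutually inverse matrices. -/
def IsGLEntry (x : Bool × Fin n × Fin n → K) : Prop :=
  ∀ p : Bool × Fin n × Fin n, ∑ k, x (p.1, p.2.1, k) * x (!p.1, k, p.2.2) =
    if p.2.1 = p.2.2 then 1 else 0

theorem isGLEntry_iff (x : Bool × Fin n × Fin n → K) : IsGLEntry x ↔ ∃ A, glEntry A = x := by
  constructor
  · intro h
    refine ⟨⟨Matrix.of fun i j => x (true, i, j), Matrix.of fun i j => x (false, i, j), ?_, ?_⟩, ?_⟩
    · ext i j
      simpa [Matrix.mul_apply, Matrix.one_apply] using h (true, i, j)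
    · ext i j
      simpa [Matrix.mul_apply, Matrix.one_apply] using h (false, i, j)
    · funext ⟨b, i, j⟩
      cases b <;> rfl
  · rintro ⟨A, rfl⟩ p
    have h := glEntry_mul (if p.1 then A else A⁻¹) (if p.1 then A⁻¹ else A) p
    obtain ⟨b, i, j⟩ := p
    cases b
    · simpa [glEntry_one, glEntry_inv] using h.symm
    · simpa [glEntry_one, glEntry_inv] using h.symm

theorem SameTerm.ite_one_zero {α : Type*} (c : Prop) [Decidable c] :
    SameTerm (fun _ : α → K => if c then (1 : K) else 0)
      (fun _ : α → K' => if c then (1 : K') else 0) := by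
  split_ifs
  · exact .one
  · exact .zero

/-- Carrying the inverse's entries along makes inversion a swap of coordinates and multiplication
polynomial, so no division is needed. -/
theorem exists_sameTerm_glEntry {m : ℕ} (t : groupLanguage.Term (Empty ⊕ Fin m)) :
    ∃ (f : Bool × Fin n × Fin n → (Fin m × Bool × Fin n × Fin n → K) → K)
      (f' : Bool × Fin n × Fin n → (Fin m × Bool × Fin n × Fin n → K') → K'),
      (∀ p, SameTerm (f p) (f' p)) ∧
      (∀ g p, f p (glEntries g) = glEntry (t.realize (Sum.elim default g)) p) ∧
      ∀ g p, f' p (glEntries g) = glEntry (t.realize (Sum.elim default g)) p := by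
  induction t with
  | var a =>
    rcases a with a | a
    · exact a.elim
    · exact ⟨fun p v => v (a, p), fun p v => v (a, p), fun p => .var _, fun _ _ => rfl,
        fun _ _ => rfl⟩
  | func F ts ih =>
    choose f f' hs hf hf' using ih
    cases F
    · refine ⟨fun p v => ∑ k, f (if p.1 then 0 else 1) (p.1, p.2.1, k) v *
          f (if p.1 then 1 else 0) (p.1, k, p.2.2) v,
        fun p v => ∑ k, f' (if p.1 then 0 else 1) (p.1, p.2.1, k) v *
          f' (if p.1 then 1 else 0) (p.1, k, p.2.2) v,
        fun p => .sum _ fun k => .mul (hs _ _) (hs _ _), fun g p => ?_, fun g p => ?_⟩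
      · refine Eq.trans ?_ (glEntry_mul ((ts 0).realize (Sum.elim default g))
          ((ts 1).realize (Sum.elim default g)) p).symm
        obtain ⟨b, i, j⟩ := p
        cases b <;> simp [hf]
      · refine Eq.trans ?_ (glEntry_mul ((ts 0).realize (Sum.elim default g))
          ((ts 1).realize (Sum.elim default g)) p).symm
        obtain ⟨b, i, j⟩ := p
        cases b <;> simp [hf']
    · refine ⟨fun p => f 0 (!p.1, p.2), fun p => f' 0 (!p.1, p.2), fun p => hs _ _,
        fun g p => ?_, fun g p => ?_⟩
      · exact (hf _ _ _).trans (glEntry_inv ((ts 0).realize (Sum.elim default g)) p).symm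
      · exact (hf' _ _ _).trans (glEntry_inv ((ts 0).realize (Sum.elim default g)) p).symm
    · exact ⟨fun p _ => if p.2.1 = p.2.2 then 1 else 0, fun p _ => if p.2.1 = p.2.2 then 1 else 0,
        fun p => .ite_one_zero _, fun g p => (glEntry_one p).symm,
        fun g p => (glEntry_one p).symm⟩

/-- Placing the entries of the last matrix of a tuple in a separate block of variables. -/
def splitLast {m : ℕ} {ι : Type*} (p : Fin (m + 1) × ι) : (Fin m × ι) ⊕ ι :=
  Fin.lastCases (motive := fun _ => (Fin m × ι) ⊕ ι) (Sum.inr p.2) (fun i => Sum.inl (i, p.2)) p.1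

theorem glEntries_snoc {m : ℕ} (g : Fin m → GL (Fin n) K) (A : GL (Fin n) K) :
    (fun p => Sum.elim (glEntries g) (glEntry A) (splitLast p)) =
      glEntries (Fin.snoc g A : Fin (m + 1) → GL (Fin n) K) := by
  funext ⟨i, p⟩
  refine Fin.lastCases ?_ (fun i => ?_) i <;> simp [splitLast, glEntries]

theorem SameFormula.isGLEntry {α : Type*} (e : Bool × Fin n × Fin n → α) :
    SameFormula (fun v : α → K => IsGLEntry fun p => v (e p))
      (fun v : α → K' => IsGLEntry fun p => v (e p)) := by
  unfold IsGLEntry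
  exact .forall_finite fun p => .eq (.sum _ fun k => .mul (.var _) (.var _)) (.ite_one_zero _)

/-- A quantifier over invertible matrices becomes one over `2n²` field elements, relativized to
`IsGLEntry`. -/
theorem exists_sameFormula_glEntry {m : ℕ} (φ : groupLanguage.BoundedFormula Empty m) :
    ∃ (P : (Fin m × Bool × Fin n × Fin n → K) → Prop)
      (P' : (Fin m × Bool × Fin n × Fin n → K') → Prop), SameFormula P P' ∧
      (∀ g, P (glEntries g) ↔ φ.Realize default g) ∧
      ∀ g, P' (glEntries g) ↔ φ.Realize default g := by
  induction φ with
  | falsum =>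
    exact ⟨fun _ => (0 : K) ≠ 0, fun _ => (0 : K') ≠ 0, .ne .zero .zero,
      fun _ => ⟨fun h => h rfl, fun h => h.elim⟩, fun _ => ⟨fun h => h rfl, fun h => h.elim⟩⟩
  | equal s t =>
    obtain ⟨f, f', h, hf, hf'⟩ := exists_sameTerm_glEntry (n := n) (K := K) (K' := K') s
    obtain ⟨u, u', k, hu, hu'⟩ := exists_sameTerm_glEntry (n := n) (K := K) (K' := K') t
    refine ⟨fun v => ∀ p, f p v = u p v, fun v => ∀ p, f' p v = u' p v,
      .forall_finite fun p => .eq (h p) (k p), fun g => ?_, fun g => ?_⟩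
    · simp only [hf, hu, BoundedFormula.Realize]
      exact funext_iff.symm.trans glEntry_injective.eq_iff
    · simp only [hf', hu', BoundedFormula.Realize]
      exact funext_iff.symm.trans glEntry_injective.eq_iff
  | rel r => exact r.elim
  | imp φ₁ φ₂ ih₁ ih₂ =>
    obtain ⟨P, P', h, hP, hP'⟩ := ih₁
    obtain ⟨Q, Q', k, hQ, hQ'⟩ := ih₂
    exact ⟨_, _, h.imp k, fun g => by simp only [hP, hQ, BoundedFormula.realize_imp],
      fun g => by simp only [hP', hQ', BoundedFormula.realize_imp]⟩
  | @all m φ ih =>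
    obtain ⟨P, P', h, hP, hP'⟩ := ih
    refine ⟨fun v => ∀ x : Bool × Fin n × Fin n → K, IsGLEntry x →
        P fun p => Sum.elim v x (splitLast p),
      fun v => ∀ x : Bool × Fin n × Fin n → K', IsGLEntry x →
        P' fun p => Sum.elim v x (splitLast p), ?_, fun g => ?_, fun g => ?_⟩
    · refine .all_tuple (.imp (.isGLEntry _) ?_)
      convert h.relabel (splitLast (m := m) (ι := Bool × Fin n × Fin n)) using 3 <;>
      · funext p
        rcases splitLast p with q | q <;> rfl
    · simp only [BoundedFormula.realize_all, isGLEntry_iff, forall_exists_index,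
        forall_apply_eq_imp_iff, glEntries_snoc, hP]
    · simp only [BoundedFormula.realize_all, isGLEntry_iff, forall_exists_index,
        forall_apply_eq_imp_iff, glEntries_snoc, hP']

end

theorem groupElemEquiv_GL_of_model {L : Type*} [Field L]
    (hL : letI := fieldStructure L; theoryRat.Model L) (n : ℕ) :
    GroupElemEquiv (GL (Fin n) ℚ) (GL (Fin n) L) := by
  refine elementarilyEquivalent_iff.2 fun φ => ?_
  obtain ⟨P, P', h, hP, hP'⟩ := exists_sameFormula_glEntry (n := n) (K := ℚ) (K' := L) φ
  have h' := h.relabel (fun a => (a.1.elim0 : Empty))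
  have e : ∀ w, (fun v : Empty → ℚ => P fun a => v (a.1.elim0)) = fun _ => P w := fun w =>
    funext fun v => congrArg P (Subsingleton.elim _ _)
  have e' : ∀ w, (fun v : Empty → L => P' fun a => v (a.1.elim0)) = fun _ => P' w := fun w =>
    funext fun v => congrArg P' (Subsingleton.elim _ _)
  rw [e (glEntries default), e' (glEntries default)] at h'
  have ht := h'.transfer hL
  rw [hP, hP'] at ht
  unfold Sentence.Realize Formula.Realize
  convert ht

end

/-! ### Divisible groups as rational vector spaces, and the splitting of `GL_n(L)` -/

section

open FirstOrder Language

attribute [local instance] groupStructure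

open Filter in
theorem groupElemEquiv_germ (U : Ultrafilter ℕ) (G : Type*) [Group G] :
    GroupElemEquiv G (Germ (U : Filter ℕ) G) := by
  -- Łoś's theorem is stated for the ultraproduct structure, which `f` matches with the group
  -- structure on germs.
  let f : (U : Filter ℕ).Product (fun _ => G) ≃[groupLanguage] Germ (U : Filter ℕ) G :=
    { toFun := fun x => x
      invFun := fun x => x
      left_inv := fun _ => rfl
      right_inv := fun _ => rfl
      map_fun' := fun {n} f x => by
        obtain ⟨y, rfl⟩ : ∃ y : Fin n → ℕ → G, x = fun i => (y i : (U : Filter ℕ).Product _) :=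
          ⟨fun i => (x i).out, funext fun i => (Quotient.out_eq (x i)).symm⟩
        refine (Ultraproduct.funMap_cast f y).trans ?_
        cases f <;> rfl
      map_rel' := fun r => r.elim }
  have hlos : ((U : Filter ℕ).Product fun _ => G) ≅[groupLanguage] G :=
    elementarilyEquivalent_iff.2 fun φ =>
      (Ultraproduct.sentence_realize (M := fun _ : ℕ => G) φ).trans eventually_const
  exact hlos.symm.trans f.toElementaryEmbedding.elementarilyEquivalent

open Filter in
theorem aleph0_le_rank_germ (V : Type*) [AddCommGroup V] [Module ℚ V] [Nontrivial V] :
    Cardinal.aleph0 ≤ Module.rank ℚ (Germ (hyperfilter ℕ : Filter ℕ) V) := by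
  obtain ⟨v, hv⟩ := exists_ne (0 : V)
  -- The germs `k ↦ p(k) • v` are independent for independent polynomials, as a nonzero `p` has
  -- finitely many roots and the ultrafilter contains no finite set.
  let f : Polynomial ℚ →ₗ[ℚ] Germ (hyperfilter ℕ : Filter ℕ) V :=
    { toFun := fun p => ((fun k : ℕ => p.eval (k : ℚ) • v : ℕ → V) : Germ _ V)
      map_add' := fun p q => by
        rw [← Germ.coe_add]
        congr 1
        funext k
        simp [add_smul]
      map_smul' := fun c p => by
        rw [RingHom.id_apply, ← Germ.coe_smul]
        congr 1
        funext k
        simp [mul_smul] }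
  have hf : Function.Injective f := by
    rw [← LinearMap.ker_eq_bot, LinearMap.ker_eq_bot']
    intro p hp
    have h1 : ∀ᶠ k : ℕ in (hyperfilter ℕ : Filter ℕ), p.eval (k : ℚ) • v = 0 :=
      Germ.coe_eq.1 hp
    have h2 : {k : ℕ | p.eval (k : ℚ) • v = 0}.Infinite := fun h =>
      Set.Finite.notMem_hyperfilter h h1
    refine Polynomial.eq_zero_of_infinite_isRoot p
      ((h2.image (Nat.cast_injective (R := ℚ)).injOn).mono ?_)
    rintro _ ⟨k, hk, rfl⟩
    exact (smul_eq_zero.1 hk).resolve_right hv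
  have h3 := LinearMap.lift_rank_le_of_injective f hf
  rw [← (Polynomial.basisMonomials ℚ).mk_eq_rank''] at h3
  simpa using h3

theorem nonempty_prod_self_linearEquiv {W : Type*} [AddCommGroup W] [Module ℚ W]
    (h : Cardinal.aleph0 ≤ Module.rank ℚ W) : Nonempty ((W × W) ≃ₗ[ℚ] W) := by
  apply nonempty_linearEquiv_of_rank_eq
  rw [rank_prod', Cardinal.add_eq_self h]

/-- A torsion-free divisible group equals its divisible hull, which carries the rational vector
space structure. -/
theorem exists_mulEquiv_rat_module {D : Type*} [CommGroup D] [IsMulTorsionFree D]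
    (hD : IsDivisibleGroup D) :
    Nonempty (D ≃* Multiplicative (DivisibleHull (Additive D))) := by
  refine ⟨AddEquiv.toMultiplicativeRight (AddEquiv.ofBijective
    (DivisibleHull.coeAddMonoidHom (M := Additive D)) ⟨DivisibleHull.coe_injective, fun x => ?_⟩)⟩
  induction x using DivisibleHull.ind with
  | mk m s =>
    obtain ⟨e, he⟩ := hD s s.pos m.toMul
    refine ⟨Additive.ofMul e, ?_⟩
    refine DivisibleHull.mk_eq_mk_iff_smul_eq_smul.2 ?_
    rw [PNat.one_coe, one_smul]
    exact congrArg Additive.ofMul he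

open Filter in
theorem IsDivisibleGroup.prod_self_groupElemEquiv {D : Type*} [CommGroup D] [Nontrivial D]
    [IsMulTorsionFree D] (hD : IsDivisibleGroup D) : GroupElemEquiv (D × D) D := by
  obtain ⟨e⟩ := exists_mulEquiv_rat_module hD
  set V := DivisibleHull (Additive D)
  have : Nontrivial V := e.symm.toEquiv.nontrivial
  let E := Germ (hyperfilter ℕ : Filter ℕ) (Multiplicative V)
  let W := Germ (hyperfilter ℕ : Filter ℕ) V
  have hDE : GroupElemEquiv D E :=
    (GroupElemEquiv.of_mulEquiv e).trans (groupElemEquiv_germ _ _)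
  obtain ⟨l⟩ := nonempty_prod_self_linearEquiv (aleph0_le_rank_germ V)
  let ψ : E ≃* Multiplicative W :=
    { toFun := fun x => x
      invFun := fun x => x
      left_inv := fun _ => rfl
      right_inv := fun _ => rfl
      map_mul' := fun x y => by
        induction x, y using Germ.inductionOn₂
        rfl }
  have hEE : E × E ≃* E := (MulEquiv.prodCongr ψ ψ).trans
    (MulEquiv.prodMultiplicative W W |>.symm.trans
      ((AddEquiv.toMultiplicative l.toAddEquiv).trans ψ.symm))
  -- With `E` the ultrapower: `D × D ≡ E × D ≅ D × E ≡ E × E ≅ E ≡ D`.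
  exact (hDE.prod_right D).trans ((GroupElemEquiv.of_mulEquiv MulEquiv.prodComm).trans
    ((hDE.prod_right E).trans ((GroupElemEquiv.of_mulEquiv hEE).trans hDE.symm)))

/-- A group with a retraction onto a central subgroup is a direct product. -/
noncomputable def mulEquivKerProd {G D : Type*} [Group G] [Group D] (ι : D →* G) (ρ : G →* D)
    (hρ : ∀ d, ρ (ι d) = d) (hι : ∀ d g, Commute (ι d) g) : G ≃* ρ.ker × D where
  toFun g := (⟨g * (ι (ρ g))⁻¹, by simp [MonoidHom.mem_ker, hρ]⟩, ρ g)
  invFun p := p.1 * ι p.2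
  left_inv g := by simp
  right_inv p := by
    obtain ⟨⟨h, hh⟩, d⟩ := p
    have hh' : ρ h = 1 := hh
    simp [hρ, hh']
  map_mul' g h := by
    refine Prod.ext (Subtype.ext ?_) (map_mul ρ g h)
    simp only [map_mul, mul_inv_rev, Prod.fst_mul, Subgroup.coe_mul]
    have := ((hι (ρ g) h).inv_left).eq
    rw [((hι (ρ h) (ι (ρ g))⁻¹).inv_left).eq, mul_assoc g h, ← mul_assoc h, ← this]
    simp only [mul_assoc]

/-- Divisible abelian groups are injective (Baer), so the identity of `D` extends to `A`. -/
theorem exists_retraction {A : Type*} [CommGroup A] (D : Subgroup A) (hD : IsDivisibleGroup D) :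
    ∃ π : A →* D, ∀ d : D, π d = d := by
  let _ : DivisibleBy (Additive D) ℕ := divisibleByOfSMulRightSurj _ _ fun {m} hm d =>
    (hD m (Nat.one_le_iff_ne_zero.2 hm) d.toMul).imp fun _ he => congrArg Additive.ofMul he
  let _ : DivisibleBy (Additive D) ℤ := AddGroup.divisibleByIntOfDivisibleByNat (Additive D)
  obtain ⟨h, hh⟩ := (Module.Baer.of_divisible (Additive D)).extension_property_addMonoidHom
    (MonoidHom.toAdditive D.subtype) Subtype.val_injective (AddMonoidHom.id (Additive D))
  exact ⟨MonoidHom.toAdditive.symm h, fun d => DFunLike.congr_fun hh (Additive.ofMul d)⟩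

open Matrix

/-- `D` embeds as scalars, on which the determinant is `d ^ n`. The `n`-th power map is an
automorphism of `D`, so the `n`-th root of `π ∘ det` is a retraction onto this central copy. -/
theorem exists_GL_mulEquiv_prod {L : Type*} [Field L] {n : ℕ} (hn : n ≠ 0) (D : Subgroup Lˣ)
    [IsMulTorsionFree D] (hD : IsDivisibleGroup D) :
    ∃ H : Subgroup (GL (Fin n) L), Nonempty (GL (Fin n) L ≃* H × D) := by
  obtain ⟨π, hπ⟩ := exists_retraction D hD
  let e : D ≃* D := MulEquiv.ofBijective (powMonoidHom n)
    ⟨pow_left_injective hn, hD n (Nat.one_le_iff_ne_zero.2 hn)⟩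
  let ι : D →* GL (Fin n) L := (GeneralLinearGroup.scalar (Fin n)).comp D.subtype
  let ρ : GL (Fin n) L →* D := e.symm.toMonoidHom.comp (π.comp GeneralLinearGroup.det)
  refine ⟨ρ.ker, ⟨mulEquivKerProd ι ρ (fun d => ?_) (fun d g => ?_)⟩⟩
  · have hdet : GeneralLinearGroup.det (ι d) = (d : Lˣ) ^ n := by
      ext
      simp [ι, GeneralLinearGroup.scalar]
    change e.symm (π (GeneralLinearGroup.det (ι d))) = d
    rw [hdet, map_pow, hπ, MulEquiv.symm_apply_eq]
    rfl
  · have hc : ι d ∈ Subgroup.center (GL (Fin n) L) := by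
      rw [GeneralLinearGroup.center_eq_range_scalar]
      exact ⟨d, rfl⟩
    exact (Subgroup.mem_center_iff.1 hc g).symm

theorem groupElemEquiv_GL_prod {L : Type*} [Field L]
    (hL : letI := fieldStructure L; theoryRat.Model L) {n : ℕ} (hn : n ≠ 0) (D : Subgroup Lˣ)
    (hbot : D ≠ ⊥) [IsMulTorsionFree D] (hD : IsDivisibleGroup D) :
    GroupElemEquiv (GL (Fin n) ℚ × D) (GL (Fin n) ℚ) := by
  have : Nontrivial D := (Subgroup.nontrivial_iff_ne_bot D).2 hbot
  have hQL := groupElemEquiv_GL_of_model hL n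
  obtain ⟨H, ⟨e⟩⟩ := exists_GL_mulEquiv_prod hn D hD
  have h1 : (GL (Fin n) L × D) ≃* (D × D) × H :=
    (MulEquiv.prodCongr e (MulEquiv.refl D)).trans (MulEquiv.prodAssoc.trans MulEquiv.prodComm)
  exact (hQL.prod_right D).trans ((GroupElemEquiv.of_mulEquiv h1).trans
    ((hD.prod_self_groupElemEquiv.prod_right H).trans ((GroupElemEquiv.of_mulEquiv
      (MulEquiv.prodComm.trans e.symm)).trans hQL.symm)))

end

/-! ### `GL_n(ℚ) × D` is not a general linear group over a field -/

section

open Matrix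

section

variable {n : Type*} [Fintype n] [DecidableEq n] {F : Type*} [Field F]

theorem exists_pow_forall_eq_one {K : Type*} [Field K] {S : Set K} (hS : S.Finite)
    (h0 : ∀ x ∈ S, x ≠ 0) (hpow : ∀ x ∈ S, ∀ k : ℕ, k ≠ 0 → x ^ k ∈ S) :
    ∃ N : ℕ, N ≠ 0 ∧ ∀ x ∈ S, x ^ N = 1 := by
  have hfin : ∀ x ∈ S, orderOf x ≠ 0 := by
    intro x hx
    rw [Ne, orderOf_eq_zero_iff, not_not]
    have hmaps : Set.MapsTo (fun k : ℕ => x ^ (k + 1)) Set.univ S := fun k _ =>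
      hpow x hx _ k.succ_ne_zero
    obtain ⟨a, -, b, -, hab, h⟩ :=
      Set.infinite_univ.exists_ne_map_eq_of_mapsTo hmaps hS
    wlog hlt : a < b generalizing a b
    · exact this b a hab.symm h.symm (by lia)
    rw [isOfFinOrder_iff_pow_eq_one]
    refine ⟨b - a, by lia, ?_⟩
    apply mul_left_cancel₀ (pow_ne_zero (a + 1) (h0 x hx))
    have h' : x ^ (a + 1) = x ^ (b + 1) := h
    rw [← pow_add, mul_one, h']
    congr 1
    lia
  refine ⟨∏ x ∈ hS.toFinset, orderOf x, ?_, fun x hx => ?_⟩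
  · exact Finset.prod_ne_zero_iff.2 fun x hx => hfin x (hS.mem_toFinset.1 hx)
  · exact orderOf_dvd_iff_pow_eq_one.1 (Finset.dvd_prod_of_mem _ (hS.mem_toFinset.2 hx))

theorem isNilpotent_sub_one_of_spectrum {K : Type*} [Field K] [IsAlgClosed K] (A : Matrix n n K)
    (h : ∀ x ∈ spectrum K A, x = 1) : IsNilpotent (A - 1) := by
  have hs := (IsAlgClosed.splits A.charpoly).eq_prod_roots_of_monic A.charpoly_monic
  have hr : A.charpoly.roots = Multiset.replicate A.charpoly.roots.card 1 :=
    Multiset.eq_replicate_card.2 fun x hx =>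
      h x (mem_spectrum_iff_isRoot_charpoly.2 (Polynomial.isRoot_of_mem_roots hx))
  refine ⟨A.charpoly.roots.card, ?_⟩
  have hc := A.aeval_self_charpoly
  rw [hs, hr] at hc
  simpa using hc

/-- Over the algebraic closure the finite spectrum is stable under powers, so it consists of roots
of unity; being also the spectrum of some `X ^ N` with all eigenvalues 1, it is contained in `{1}`.
-/
theorem isNilpotent_sub_one_of_conj_pow (X : GL n F)
    (h : ∀ k : ℕ, k ≠ 0 → ∃ g : GL n F, g * X * g⁻¹ = X ^ k) :
    IsNilpotent (X.val - 1) := by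
  let i := algebraMap F (AlgebraicClosure F)
  let Y : GL n (AlgebraicClosure F) := GeneralLinearGroup.map i X
  have hspec : ∀ k : ℕ, k ≠ 0 →
      spectrum (AlgebraicClosure F) (Y.val ^ k) = spectrum (AlgebraicClosure F) Y.val := by
    intro k hk
    obtain ⟨g, hg⟩ := h k hk
    have hg' := congrArg Units.val (congrArg (GeneralLinearGroup.map i) hg)
    simp only [map_mul, map_pow, map_inv, Units.val_mul, Units.val_pow_eq_pow_val] at hg'
    rw [← hg', spectrum.units_conjugate]
  obtain ⟨N, hN, hN1⟩ := exists_pow_forall_eq_one (Y.val.finite_spectrum)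
    (fun x hx => fun h0 => spectrum.zero_notMem (AlgebraicClosure F) Y.isUnit (h0 ▸ hx))
    (fun x hx k hk => by rw [← hspec k hk]; exact spectrum.pow_mem_pow _ k hx)
  have hnil : IsNilpotent (Y.val - 1) := by
    refine isNilpotent_sub_one_of_spectrum _ fun x hx => ?_
    rw [← hspec N hN, spectrum.map_pow_of_pos _ (Nat.pos_of_ne_zero hN)] at hx
    obtain ⟨y, hy, rfl⟩ := hx
    exact hN1 y hy
  obtain ⟨m, hm⟩ := hnil
  refine ⟨m, ?_⟩
  have hinj : Function.Injective (i.mapMatrix : Matrix n n F →+* _) :=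
    Matrix.map_injective i.injective
  apply hinj
  rw [map_pow, map_sub, map_one, map_zero]
  exact hm

/-- Elementary transvections as elements of the general linear group. -/
def glTransvection {i j : n} (hij : i ≠ j) (c : F) : GL n F :=
  ⟨transvection i j c, transvection i j (-c),
    by rw [transvection_mul_transvection_same _ _ hij, add_neg_cancel, transvection_zero],
    by rw [transvection_mul_transvection_same _ _ hij, neg_add_cancel, transvection_zero]⟩

theorem commute_glTransvection_iff {i j : n} (hij : i ≠ j) (g : GL n F) :
    Commute (glTransvection hij (1 : F)) g ↔ Commute (single i j (1 : F)) g.val := by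
  rw [← Commute.units_val_iff]
  change Commute (1 + single i j (1 : F)) _ ↔ _
  constructor
  · intro h
    simpa using h.sub_left (Commute.one_left _)
  · exact fun h => (Commute.one_left _).add_left h

theorem glTransvection_pow {i j : n} (hij : i ≠ j) (c : F) (k : ℕ) :
    glTransvection hij c ^ k = glTransvection hij (k * c) := by
  induction k with
  | zero =>
    apply Units.ext
    simp [glTransvection]
  | succ k ih =>
    rw [pow_succ, ih]
    apply Units.ext
    change transvection i j _ * transvection i j _ = transvection i j _
    rw [transvection_mul_transvection_same _ _ hij]
    push_cast
    rw [add_mul, one_mul]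

theorem exists_conj_glTransvection {i j : n} (hij : i ≠ j) {c : F} (hc : c ≠ 0) :
    ∃ g : GL n F, g * glTransvection hij 1 * g⁻¹ = glTransvection hij c := by
  refine ⟨GeneralLinearGroup.mkOfDetNeZero (diagonal (Function.update 1 i c)) ?_, ?_⟩
  · rw [det_diagonal, Finset.prod_ne_zero_iff]
    intro k _
    by_cases hk : k = i
    · simpa [hk] using hc
    · simp [hk]
  · rw [mul_inv_eq_iff_eq_mul]
    apply Units.ext
    change diagonal _ * (1 + single i j 1) = (1 + single i j c) * diagonal _
    rw [mul_add, add_mul, mul_one, one_mul]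
    congr 1
    ext a b
    simp only [diagonal_mul, mul_diagonal, single_apply]
    by_cases ha : i = a <;> by_cases hb : j = b <;> simp [ha, hb]
    subst ha hb
    simp [hij.symm]

/-- The elementary matrices `E_kl` with `k ≠ l`, `k ≠ j`, `l ≠ i` commute with `E_ij`. Commuting
with all of them equates the diagonal entries of `h` and kills the off-diagonal ones except at `(i,
j)`. -/
theorem eq_of_commute_centralizer {i j : n} (hij : i ≠ j) (h : GL n F)
    (hh : ∀ g : GL n F, Commute (glTransvection hij (1 : F)) g → Commute h g) :
    h.val = scalar n (h.val i i) + single i j (h.val i j) := by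
  have key : ∀ {k l : n}, k ≠ l → k ≠ j → l ≠ i → Commute (single k l (1 : F)) h.val := by
    intro k l hkl hkj hli
    rw [← commute_glTransvection_iff hkl]
    refine (hh _ ?_).symm
    rw [commute_glTransvection_iff]
    change Commute _ (1 + single k l (1 : F))
    refine (Commute.one_right _).add_right ?_
    rw [commute_iff_eq, single_mul_single_of_ne _ _ _ _ hkj.symm,
      single_mul_single_of_ne _ _ _ _ hli]
  ext a b
  by_cases ha : a = i
  · subst ha
    by_cases hb : b = a
    · subst hb
      simp [hij.symm]
    · by_cases hbj : b = j
      · subst hbj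
        simp [hij]
      · rw [col_eq_zero_of_commute_single (key hbj hbj hij.symm) (Ne.symm hb)]
        simp [Ne.symm hb, Ne.symm hbj]
  · by_cases hb : b = a
    · subst hb
      rw [diag_eq_of_commute_single (key (Ne.symm ha) hij ha)]
      simp [Ne.symm ha]
    · rw [row_eq_zero_of_commute_single (key (Ne.symm ha) hij ha) hb]
      simp [Ne.symm ha, Ne.symm hb]

end

theorem nonempty_ringEquiv_rat_of_injective {F : Type*} [Field F] (φ : F →+ ℚ)
    (hφ : Function.Injective φ) : Nonempty (F ≃+* ℚ) := by
  have h1 : φ 1 ≠ 0 := (map_ne_zero_iff φ hφ).2 one_ne_zero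
  have : CharZero F := charZero_of_inj_zero fun n hn => by
    have h2 : φ (n • (1 : F)) = 0 := by rw [nsmul_one, hn, map_zero]
    rw [map_nsmul, nsmul_eq_mul, mul_eq_zero] at h2
    exact_mod_cast h2.resolve_right h1
  refine ⟨(RingEquiv.ofBijective (Rat.castHom F) ⟨(Rat.castHom F).injective, fun x => ?_⟩).symm⟩
  set q := φ x / φ 1 with hq
  have h2 : (q.den : F) * x = q.num := by
    apply hφ
    have e1 : φ ((q.den : F) * x) = q.den * φ x := by
      rw [← nsmul_eq_mul, map_nsmul, nsmul_eq_mul]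
    have e2 : φ (q.num : F) = q.num * φ 1 := by
      rw [← zsmul_one, map_zsmul, zsmul_eq_mul]
    rw [e1, e2, ← Rat.mul_den_eq_num, hq]
    field_simp
  refine ⟨q, ?_⟩
  have hd : (q.den : F) ≠ 0 := by exact_mod_cast q.den_nz
  change ((q : ℚ) : F) = x
  rw [Rat.cast_def, ← h2, mul_div_cancel_left₀ _ hd]

theorem Rat.eq_one_of_forall_exists_pow_eq {q : ℚ} (h0 : q ≠ 0)
    (h : ∀ m : ℕ, 1 ≤ m → ∃ r : ℚ, r ^ m = q) : q = 1 := by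
  have key : ∀ (N : ℕ), N ≠ 0 → (∀ m : ℕ, 1 ≤ m → ∃ r : ℕ, r ^ m = N) → N = 1 := by
    intro N hN h
    -- Taking the root of order `N` itself: `r ≥ 2` would give `r ^ N ≥ 2 ^ N > N`.
    obtain ⟨r, hr⟩ := h N (Nat.one_le_iff_ne_zero.2 hN)
    by_contra hN1
    have hr2 : 2 ≤ r := by
      by_contra hlt
      have : r = 0 ∨ r = 1 := by lia
      rcases this with rfl | rfl
      · exact hN (by rw [← hr, zero_pow hN])
      · exact hN1 (by rw [← hr, one_pow])
    have := Nat.pow_le_pow_left hr2 N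
    have := Nat.lt_two_pow_self (n := N)
    lia
  have hden : q.den = 1 := key _ q.den_nz fun m hm => by
    obtain ⟨r, rfl⟩ := h m hm
    exact ⟨r.den, (Rat.den_pow r m).symm⟩
  have hnum : q.num.natAbs = 1 := key _ (by simpa using h0) fun m hm => by
    obtain ⟨r, rfl⟩ := h m hm
    exact ⟨r.num.natAbs, by rw [Rat.num_pow, Int.natAbs_pow]⟩
  obtain ⟨r, hr⟩ := h 2 (by norm_num)
  have hpos : 0 ≤ q.num := Rat.num_nonneg.2 (hr ▸ sq_nonneg r)
  have hn1 : q.num = 1 := by lia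
  rw [← Rat.num_div_den q, hden, hn1]
  norm_num

section

variable {n : Type*} [Fintype n] [DecidableEq n] {F : Type*} [Field F]

/-- The one-parameter group `a ↦ 1 + a • B` attached to a matrix `B` of square zero. -/
def glOneAddSMul (B : Matrix n n F) (hB : B * B = 0) : Multiplicative F →* GL n F :=
  MonoidHom.toHomUnits
    { toFun := fun a => 1 + a.toAdd • B
      map_one' := by simp
      map_mul' := fun a b => by
        simp only [toAdd_mul, add_mul, mul_add, one_mul, mul_one, smul_mul_assoc,
          mul_smul_comm, hB, smul_zero, add_zero, add_smul]
        abel }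

theorem glOneAddSMul_val (B : Matrix n n F) (hB : B * B = 0) (a : Multiplicative F) :
    (glOneAddSMul B hB a).val = 1 + a.toAdd • B := rfl

theorem eq_one_of_glOneAddSMul_mem_center [Nonempty n] {B : Matrix n n F} (hB : B * B = 0)
    (hB0 : B ≠ 0) {a : Multiplicative F} (ha : glOneAddSMul B hB a ∈ Subgroup.center (GL n F)) :
    a = 1 := by
  rw [GeneralLinearGroup.center_eq_range_scalar] at ha
  obtain ⟨c, hc⟩ := ha
  have h1 : scalar n (c : F) = 1 + a.toAdd • B := congrArg Units.val hc
  have h2 : scalar n ((c : F) - 1) = a.toAdd • B := by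
    rw [map_sub, h1, map_one, add_sub_cancel_left]
  have h3 : scalar n (((c : F) - 1) * (c - 1)) = 0 := by
    rw [map_mul, h2, smul_mul_smul_comm, hB, smul_zero]
  have h4 : (c : F) - 1 = 0 := by
    rw [← map_zero (scalar n), scalar_inj] at h3
    exact mul_self_eq_zero.1 h3
  rw [h4, map_zero] at h2
  exact (smul_eq_zero.1 h2.symm).resolve_right hB0

theorem exists_mul_self_eq_zero_of_isNilpotent {R : Type*} [Ring R] {N : R} (hN : IsNilpotent N)
    (h0 : N ≠ 0) : ∃ r : ℕ, N ^ r ≠ 0 ∧ N ^ r * N ^ r = 0 := by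
  have : Nontrivial R := ⟨N, 0, h0⟩
  have h2 : 2 ≤ nilpotencyClass N := by
    by_contra hlt
    have := pos_nilpotencyClass_iff.2 hN
    exact h0 (nilpotencyClass_eq_one.1 (by lia))
  refine ⟨nilpotencyClass N - 1, pow_pred_nilpotencyClass hN, ?_⟩
  rw [← pow_add]
  exact pow_eq_zero_of_le (by lia) (pow_nilpotencyClass hN)

/-- `B`, a power of `X - 1`, commutes with all that commutes with `X`. Hence the `GL_n(ℚ)` component
of the preimage of `1 + a • B` has the form `s + t E_ij`, and `a ↦ t / s` is additive. -/
theorem nonempty_ringEquiv_rat_of_mulEquiv {i j : n} (hij : i ≠ j) {D : Type*} [CommGroup D]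
    (ψ : GL n ℚ × D ≃* GL n F) : Nonempty (F ≃+* ℚ) := by
  have : Nonempty n := ⟨i⟩
  let u : GL n ℚ := glTransvection hij 1
  let X := ψ (u, 1)
  have hu : u ≠ 1 := fun h => by
    have h1 := congrArg (fun g : GL n ℚ => g.val i j) h
    simp [u, glTransvection, transvection, hij] at h1
  have hX : X.val - 1 ≠ 0 := fun h => by
    have h1 : ψ (u, 1) = 1 := Units.ext (sub_eq_zero.1 h)
    rw [map_eq_one_iff ψ ψ.injective] at h1
    exact hu (congrArg Prod.fst h1)
  have hnil : IsNilpotent (X.val - 1) := by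
    refine isNilpotent_sub_one_of_conj_pow X fun k hk => ?_
    obtain ⟨g, hg⟩ := exists_conj_glTransvection hij (c := (k : ℚ)) (by exact_mod_cast hk)
    refine ⟨ψ (g, 1), ?_⟩
    rw [← map_inv, ← map_mul, ← map_mul, ← map_pow, Prod.inv_mk, Prod.mk_mul_mk,
      Prod.mk_mul_mk, Prod.pow_mk, hg, glTransvection_pow]
    simp
  obtain ⟨r, hB0, hB⟩ := exists_mul_self_eq_zero_of_isNilpotent hnil hX
  let f := (ψ.symm : GL n F →* GL n ℚ × D).comp (glOneAddSMul _ hB)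
  have hf : ∀ a (g : GL n ℚ), Commute u g → Commute (f a).1 g := by
    intro a g hg
    have h1 : Commute X (ψ (g, 1)) := (Commute.prod hg (Commute.refl 1)).map ψ
    have h2 : Commute (glOneAddSMul _ hB a) (ψ (g, 1)) := by
      rw [← Commute.units_val_iff, glOneAddSMul_val]
      refine (Commute.one_left _).add_left (Commute.smul_left ?_ _)
      exact ((Commute.units_val_iff.2 h1).sub_left (Commute.one_left _)).pow_left r
    have h3 := h2.map (ψ.symm : GL n F →* GL n ℚ × D)
    have h4 := congrArg Prod.fst h3.eq
    simpa [commute_iff_eq, f] using h4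
  have hform := fun a => eq_of_commute_centralizer hij (f a).1 (hf a)
  have hdiag : ∀ a, (f a).1.val i i ≠ 0 := by
    intro a h0
    have h1 := hform a
    rw [h0, map_zero, zero_add] at h1
    refine ((f a).1.isUnit.mul (f a).1.isUnit).ne_zero ?_
    rw [h1, single_mul_single_of_ne _ _ _ _ hij.symm]
  let φ : F →+ ℚ :=
    { toFun := fun a => (f (.ofAdd a)).1.val i j / (f (.ofAdd a)).1.val i i
      map_zero' := by simp [hij]
      map_add' := fun a b => by
        have h1 := hdiag (.ofAdd a)
        have h2 := hdiag (.ofAdd b)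
        have h3 : (f (.ofAdd (a + b))).1.val =
            (f (.ofAdd a)).1.val * (f (.ofAdd b)).1.val := by
          rw [ofAdd_add, map_mul]; rfl
        rw [hform (.ofAdd a), hform (.ofAdd b)] at h3
        have h4 : (f (.ofAdd (a + b))).1.val i i =
            (f (.ofAdd a)).1.val i i * (f (.ofAdd b)).1.val i i := by
          rw [h3]
          simp [add_mul, mul_add, hij.symm]
        have h5 : (f (.ofAdd (a + b))).1.val i j =
            (f (.ofAdd a)).1.val i i * (f (.ofAdd b)).1.val i j +
              (f (.ofAdd a)).1.val i j * (f (.ofAdd b)).1.val i i := by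
          rw [h3]
          simp [add_mul, mul_add, hij, hij.symm]
          ring
        rw [h4, h5]
        field_simp
        ring }
  refine nonempty_ringEquiv_rat_of_injective φ ((injective_iff_map_eq_zero φ).2 fun a ha => ?_)
  have h1 : (f (.ofAdd a)).1.val i j = 0 := (div_eq_zero_iff.1 ha).resolve_right (hdiag _)
  refine ofAdd_eq_one.1 (eq_one_of_glOneAddSMul_mem_center hB hB0 ?_)
  -- If `t = 0` the first component is scalar and `D` is commutative, so the preimage is central;
  -- but `1 + a • B` is central only for `a = 0`.
  have h2 : f (.ofAdd a) ∈ Subgroup.center (GL n ℚ × D) := by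
    rw [Subgroup.mem_center_iff]
    intro g
    refine Prod.ext (Units.ext ?_) (mul_comm _ _)
    change g.1.val * (f (.ofAdd a)).1.val = (f (.ofAdd a)).1.val * g.1.val
    rw [hform, h1, single_zero, add_zero]
    exact ((scalar_commute _ (fun x => Commute.all _ x) _).eq).symm
  rw [Subgroup.mem_center_iff] at h2 ⊢
  intro g
  apply ψ.symm.injective
  rw [map_mul, map_mul]
  exact h2 _

theorem isEmpty_mulEquiv_of_isDivisibleGroup {i j : n} (hij : i ≠ j) {D : Type*} [CommGroup D]
    [Nontrivial D] (hD : IsDivisibleGroup D) : IsEmpty (GL n ℚ × D ≃* GL n F) := by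
  refine ⟨fun ψ => ?_⟩
  have : Nonempty n := ⟨i⟩
  obtain ⟨e⟩ := nonempty_ringEquiv_rat_of_mulEquiv hij ψ
  have hc : ∀ d : D, ∃ c : Fˣ, GeneralLinearGroup.scalar n c = ψ (1, d) := by
    intro d
    change ψ (1, d) ∈ (GeneralLinearGroup.scalar n).range
    rw [← GeneralLinearGroup.center_eq_range_scalar, Subgroup.mem_center_iff]
    intro g
    obtain ⟨g, rfl⟩ := ψ.surjective g
    rw [← map_mul, ← map_mul]
    congr 1
    exact Prod.ext (by simp) (mul_comm _ _)
  obtain ⟨d, hd⟩ := exists_ne (1 : D)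
  obtain ⟨c, hcd⟩ := hc d
  have hinj : Function.Injective (GeneralLinearGroup.scalar n : Fˣ →* GL n F) := fun a b h =>
    Units.ext (scalar_inj.1 (congrArg Units.val h))
  -- Roots of `d` in `D` map to central elements, hence to scalars, so `e c` is a nonzero rational
  -- with roots of every order.
  have h1 : e c = 1 := by
    refine Rat.eq_one_of_forall_exists_pow_eq (by simp) fun m hm => ?_
    obtain ⟨d', rfl⟩ := hD m hm d
    obtain ⟨c', hc'⟩ := hc d'
    refine ⟨e c', ?_⟩
    rw [← map_pow, ← Units.val_pow_eq_pow_val]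
    congr 2
    apply hinj
    rw [map_pow, hc', hcd, ← map_pow, Prod.pow_mk, one_pow]
  have h2 : c = 1 := Units.ext ((map_eq_one_iff e e.injective).1 h1)
  rw [h2, map_one, eq_comm, map_eq_one_iff ψ ψ.injective] at hcd
  exact hd (congrArg Prod.snd hcd)

end

end

theorem mainTheorem8 (n : ℕ) (hn : 3 ≤ n) (L : Type*) [Field L] [Countable L]
    (hL : IsNonstandardModelRat L) :
    (∃ D : Subgroup Lˣ, D ≠ ⊥ ∧ Countable D ∧ IsMulTorsionFree D ∧ IsDivisibleGroup D) ∧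
    ∀ D : Subgroup Lˣ, D ≠ ⊥ → IsDivisibleGroup D →
      GroupElemEquiv (Matrix.GeneralLinearGroup (Fin n) ℚ × D)
        (Matrix.GeneralLinearGroup (Fin n) ℚ) ∧
      ∀ (F : Type*) [Field F],
        IsEmpty ((Matrix.GeneralLinearGroup (Fin n) ℚ × D) ≃*
          Matrix.GeneralLinearGroup (Fin n) F) := by
  obtain ⟨hmodel, hne⟩ := hL
  refine ⟨?_, fun D hbot hD => ?_⟩
  · obtain ⟨D, hbot, hD⟩ := exists_divisible_subgroup hmodel hne
    have : Countable Lˣ := Units.val_injective.countable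
    exact ⟨D, hbot, inferInstance, isMulTorsionFree_of_isDivisibleGroup hmodel D hD, hD⟩
  · have : IsMulTorsionFree D := isMulTorsionFree_of_isDivisibleGroup hmodel D hD
    have : Nontrivial D := (Subgroup.nontrivial_iff_ne_bot D).2 hbot
    have hij : (⟨0, by lia⟩ : Fin n) ≠ ⟨1, by lia⟩ := by simp
    exact ⟨groupElemEquiv_GL_prod hmodel (by lia) D hbot hD, fun F _ =>
      isEmpty_mulEquiv_of_isDivisibleGroup hij hD⟩
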